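/- A single item is sold to $n$ agents. Agent $i$ has a private value $v_i$ in an interval $V_i\subseteq[0,\infty)$, drawn independently of the others from a distribution $F_i$ on $V_i$ with a density $f_i$, and a capacity $C_i\in(0,\infty)$; her utility of wealth $z$ is $\min(z,C_i)$. Each $F_i$ is regular, i.e. the virtual value $\varphi_i(v)=v-\frac{1-F_i(v)}{f_i(v)}$ is non-decreasing in $v$ (where $f_i(v)=0$, read $\varphi_i(v)=-\infty$ if $F_i(v)<1$ and $\varphi_i(v)=v$ if $F_i(v)=1$). An auction is a (possibly randomized) direct mechanism in which agents report values and, given the reports and the random seed, at most one agent is served, losers pay $0$, and a winner pays at most her report. Payments to a winner, i.e. negative payments, are allowed. It is Bayesian incentive compatible (BIC) if for every agent $i$ and all $v,z\in V_i$, an agent with value $v$ gets at least as much expected utility from reporting $v$ as from reporting $z$, in expectation over the seed and the truthful reports of the others. It is one-priced if a winner's payment is a deterministic function of her own value. Its revenue is the expected total payment under truthful reports, in the extended reals (the expectation of the positive part of the total payment minus that of the negative part, and $-\infty$ if both are infinite). For an interim allocation rule $x:[0,\infty)\to[0,1]$ and a capacity $C$ put $p^{RN}(v)=v\,x(v)-\int_0^v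 x(z)\,dz$ and $p^{VC}(v)=(v-C)\,x(v)$, and let $p^{C}$ be the least function on $[0,\infty)$ with $p^C(0)=0$ and $$p^C(v)=\max\Bigl(p^{VC}(v),\ \sup_{0\le u<v}\{p^C(u)+p^{RN}(v)-p^{RN}(u)\}\Bigr)\qquad(v>0),$$ namely $p^C(v)=p^{RN}(v)+\sup_{0\le u\le v}\max\bigl(p^{VC}(u)-p^{RN}(u),0\bigr)$. Given an allocation rule with interim rules $x_i$, the payment-identity mechanism charges agent $i$ with report $v$ the amount $p^{C_i}(v)/x_i(v)$ if she is served and $x_i(v)>0$, and $0$ otherwise, where $p^{C_i}$ is formed from $x_i$ and $C_i$. Theorem. Let $M_1$ be the payment-identity mechanism for the allocation that serves the agent with the largest $\varphi_i(v_i)$, if positive (the risk-neutral virtual-surplus-optimal allocation), and $M_2$ the one for the allocation that serves the agent with the largest $v_i-C_i$, if positive; ties go to the smallest index, and nobody is served if no score is positive. Then $M_1$ and $M_2$ are one-priced BIC auctions, and for the one, $M$, of larger revenue, $\mathrm{Rev}(N)\le 3\,\mathrm{Rev}(M)$ for every BIC auction $N$. In particular some one-priced BIC auction has revenue at least one third of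 the optimal revenue (over all BIC auctions, hence also over the two-priced ones, in which a winner with value $v_i$ pays $v_i$ or $v_i-C_i$). -/

import Mathlib

open MeasureTheory

noncomputable section

namespace CapacitatedAuction

/-- The capacitated utility `u_C(z) = min (z, C)` of wealth `z`. -/
def capUtility (C z : ℝ) : ℝ := min z C

/-! ### Value distributions -/

/-- `f` is a (nonnegative, measurable) density of the law `μ` on the real line. -/
structure IsDensity (μ : Measure ℝ) (f : ℝ → ℝ) : Prop where
  measurable : Measurable f
  nonneg : ∀ v, 0 ≤ f v
  eq_withDensity : μ = volume.withDensity fun v => ENNReal.ofReal (f v)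

open Classical in
/-- The virtual value `v - (1 - F v) / f v`, as an extended real. Where the density vanishes the
quotient is read as `+∞` if `F v < 1` (so the virtual value is `-∞`), and as `0` if `F v = 1`. -/
def virtualValue (μ : Measure ℝ) (f : ℝ → ℝ) (v : ℝ) : EReal :=
  if 0 < f v then ((v - (1 - ProbabilityTheory.cdf μ v) / f v : ℝ) : EReal)
  else if ProbabilityTheory.cdf μ v = 1 then (v : EReal)
  else ⊥

/-- A distribution with density `f` is regular if its virtual value is monotone non-decreasing. -/
def IsRegular (μ : Measure ℝ) (f : ℝ → ℝ) : Prop := Monotone (virtualValue μ f)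

/-! ### Single-item direct-revelation mechanisms -/

/-- The data of a direct mechanism for `n` agents with random seed in `Ω`: the law of the seed
and, for each seed, each profile of reports and each agent, whether the agent is served (`1` or `0`)
and what she pays. -/
structure Mechanism (n : ℕ) (Ω : Type*) [MeasurableSpace Ω] where
  seed : Measure Ω
  alloc : Ω → (Fin n → ℝ) → Fin n → ℝ
  pay : Ω → (Fin n → ℝ) → Fin n → ℝ

namespace Mechanism

variable {n : ℕ} {Ω : Type*} [MeasurableSpace Ω]

/-- `M` is a single-item auction on the value spaces `V i`: outcomes are measurable, at most one
agent is served, losers pay nothing, and a winner pays at most her report. -/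
structure IsAuction (M : Mechanism n Ω) (V : Fin n → Set ℝ) : Prop where
  isProbabilityMeasure_seed : IsProbabilityMeasure M.seed
  measurable_alloc : ∀ i, Measurable fun p : Ω × (Fin n → ℝ) => M.alloc p.1 p.2 i
  measurable_pay : ∀ i, Measurable fun p : Ω × (Fin n → ℝ) => M.pay p.1 p.2 i
  alloc_zero_or_one : ∀ ω v, (∀ j, v j ∈ V j) → ∀ i, M.alloc ω v i = 0 ∨ M.alloc ω v i = 1
  sum_alloc_le_one : ∀ ω v, (∀ j, v j ∈ V j) → ∑ i, M.alloc ω v i ≤ 1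
  pay_loser : ∀ ω v, (∀ j, v j ∈ V j) → ∀ i, M.alloc ω v i = 0 → M.pay ω v i = 0
  pay_winner_le : ∀ ω v, (∀ j, v j ∈ V j) → ∀ i, M.alloc ω v i = 1 → M.pay ω v i ≤ v i

/-- The expected utility of agent `i` with capacity `C` and value `v` when she reports `z` and the
other agents report their values truthfully. The expectation is over the seed and the values of the
others (the `i`-th coordinate of the random profile is overwritten by `z`). In an auction the
integrand is almost surely between `-|v - z|` and `C` when `v ≥ 0` and `C ≥ 0`. -/
def interimUtility (M : Mechanism n Ω) (μ : Fin n → Measure ℝ) (C : ℝ) (i : Fin n) (v z : ℝ) : ℝ :=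
  ∫ p : Ω × (Fin n → ℝ),
    capUtility C
      (v * M.alloc p.1 (Function.update p.2 i z) i - M.pay p.1 (Function.update p.2 i z) i)
    ∂(M.seed.prod (Measure.pi μ))

/-- Bayesian incentive compatibility: truthtelling is a Bayes-Nash equilibrium when agent `i` has
value space `V i`, capacity `C i` and value distribution `μ i`, independently of the others. -/
def IsBIC (M : Mechanism n Ω) (V : Fin n → Set ℝ) (μ : Fin n → Measure ℝ) (C : Fin n → ℝ) : Prop :=
  ∀ i, ∀ v ∈ V i, ∀ z ∈ V i,
    M.interimUtility μ (C i) i v z ≤ M.interimUtility μ (C i) i v v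

/-- One-priced: an agent who is served pays a deterministic function of her own value, and an agent
who is not served pays nothing. -/
def IsOnePriced (M : Mechanism n Ω) (V : Fin n → Set ℝ) : Prop :=
  ∃ b : Fin n → ℝ → ℝ, ∀ ω v, (∀ j, v j ∈ V j) → ∀ i,
    (M.alloc ω v i = 1 → M.pay ω v i = b i (v i)) ∧ (M.alloc ω v i = 0 → M.pay ω v i = 0)

/-- The expected revenue `E[∑ i, pay i]` under truthful reports, as an extended real: the
expectation of the positive part minus that of the negative part (`⊥` if both are infinite). -/
def revenue (M : Mechanism n Ω) (μ : Fin n → Measure ℝ) : EReal :=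
  ((∫⁻ p : Ω × (Fin n → ℝ), ENNReal.ofReal (∑ i, M.pay p.1 p.2 i)
      ∂(M.seed.prod (Measure.pi μ)) : ENNReal) : EReal)
  - ((∫⁻ p : Ω × (Fin n → ℝ), ENNReal.ofReal (-∑ i, M.pay p.1 p.2 i)
      ∂(M.seed.prod (Measure.pi μ)) : ENNReal) : EReal)

end Mechanism

/-! ### The one-price payment identity -/

/-- The risk-neutral expected payment `v * x v - ∫_0^v x` for the interim allocation rule `x`. -/
def rnPayment (x : ℝ → ℝ) (v : ℝ) : ℝ := v * x v - ∫ z in (0 : ℝ)..v, x z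

/-- The expected payment `(v - C) * x v` of an agent who pays value minus capacity upon winning. -/
def vcPayment (C : ℝ) (x : ℝ → ℝ) (v : ℝ) : ℝ := (v - C) * x v

/-- The payment identity for an interim payment rule `p`: `p 0 = 0` and, for `v > 0`, `p v` is the
maximum of `vcPayment C x v` and the supremum over `u ∈ [0, v)` of
`p u + (rnPayment x v - rnPayment x u)`. -/
def SatisfiesPaymentIdentity (C : ℝ) (x p : ℝ → ℝ) : Prop :=
  p 0 = 0 ∧ ∀ v, 0 < v →
    IsLUB (insert (vcPayment C x v)
      ((fun u => p u + (rnPayment x v - rnPayment x u)) '' Set.Ico 0 v)) (p v)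

/-- The capacitated payment rule: the least solution of the payment identity, in closed form (see
`capPayment_satisfies` and `capPayment_le`). -/
def capPayment (C : ℝ) (x : ℝ → ℝ) (v : ℝ) : ℝ :=
  rnPayment x v + sSup ((fun u => max (vcPayment C x u - rnPayment x u) 0) '' Set.Icc 0 v)

theorem bddAbove_capPayment {C : ℝ} {x : ℝ → ℝ} (hC : 0 ≤ C) (hx0 : ∀ v, 0 ≤ x v)
    (hx1 : ∀ v, x v ≤ 1) (v : ℝ) :
    BddAbove ((fun u => max (vcPayment C x u - rnPayment x u) 0) '' Set.Icc 0 v) := by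
  refine ⟨v, ?_⟩
  rintro _ ⟨u, ⟨hu0, huv⟩, rfl⟩
  have h1 : ‖∫ z in (0 : ℝ)..u, x z‖ ≤ 1 * |u - 0| :=
    intervalIntegral.norm_integral_le_of_norm_le_const fun z _ => by
      rw [Real.norm_eq_abs, abs_of_nonneg (hx0 z)]; exact hx1 z
  rw [sub_zero, abs_of_nonneg hu0, one_mul] at h1
  have h2 := (abs_le.mp h1).2
  have h3 := mul_nonneg hC (hx0 u)
  refine max_le ?_ (hu0.trans huv)
  unfold vcPayment rnPayment
  linarith

theorem capPayment_satisfies {C : ℝ} {x : ℝ → ℝ} (hC : 0 ≤ C) (hx0 : ∀ v, 0 ≤ x v)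
    (hx1 : ∀ v, x v ≤ 1) : SatisfiesPaymentIdentity C x (capPayment C x) := by
  refine ⟨?_, fun v hv => ⟨?_, ?_⟩⟩
  · have : -(C * x 0) ≤ 0 := by have := mul_nonneg hC (hx0 0); linarith
    simp [capPayment, vcPayment, rnPayment, this]
  · rintro _ (rfl | ⟨u, ⟨hu0, huv⟩, rfl⟩)
    · have h := le_csSup (bddAbove_capPayment hC hx0 hx1 v)
        (Set.mem_image_of_mem _ (Set.right_mem_Icc.mpr hv.le))
      have h' := (le_max_left (vcPayment C x v - rnPayment x v) 0).trans h
      unfold capPayment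
      linarith
    · have h := csSup_le_csSup (bddAbove_capPayment hC hx0 hx1 v)
        ((Set.nonempty_Icc.mpr hu0).image _)
        (Set.image_mono (Set.Icc_subset_Icc_right huv.le))
      simp only [capPayment]
      linarith
  · intro b hb
    have hbv : vcPayment C x v ≤ b := hb (Set.mem_insert _ _)
    have hbu : ∀ u ∈ Set.Ico 0 v, capPayment C x u + (rnPayment x v - rnPayment x u) ≤ b :=
      fun u hu => hb (Set.mem_insert_of_mem _ ⟨u, hu, rfl⟩)
    have key : ∀ u ∈ Set.Ico 0 v,
        max (vcPayment C x u - rnPayment x u) 0 ≤ b - rnPayment x v := by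
      intro u hu
      have h := le_csSup (bddAbove_capPayment hC hx0 hx1 u)
        (Set.mem_image_of_mem _ (Set.right_mem_Icc.mpr hu.1))
      have h' := hbu u hu
      unfold capPayment at h'
      linarith
    have : sSup ((fun u => max (vcPayment C x u - rnPayment x u) 0) '' Set.Icc 0 v)
        ≤ b - rnPayment x v := by
      refine csSup_le ((Set.nonempty_Icc.mpr hv.le).image _) ?_
      rintro _ ⟨u, ⟨hu0, huv⟩, rfl⟩
      rcases huv.lt_or_eq with h | rfl
      · exact key u ⟨hu0, h⟩
      · refine max_le (by linarith) ?_
        exact (le_max_right _ _).trans (key 0 ⟨le_rfl, hv⟩)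
    unfold capPayment
    linarith

theorem capPayment_le {C : ℝ} {x p : ℝ → ℝ} (hp : SatisfiesPaymentIdentity C x p)
    (hC : 0 ≤ C) (hx0 : ∀ v, 0 ≤ x v) {v : ℝ} (hv : 0 ≤ v) : capPayment C x v ≤ p v := by
  have hle : ∀ u, 0 ≤ u → vcPayment C x u ≤ p u := by
    intro u hu
    rcases hu.lt_or_eq with h | rfl
    · exact (hp.2 u h).1 (Set.mem_insert _ _)
    · rw [hp.1]
      have := mul_nonneg hC (hx0 0)
      unfold vcPayment
      linarith
  have hmono : ∀ u w, 0 ≤ u → u ≤ w → p u - rnPayment x u ≤ p w - rnPayment x w := by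
    intro u w hu huw
    rcases huw.lt_or_eq with h | rfl
    · have := (hp.2 w (hu.trans_lt h)).1 (Set.mem_insert_of_mem _ ⟨u, ⟨hu, h⟩, rfl⟩)
      dsimp only at this
      linarith
    · exact le_rfl
  have : sSup ((fun u => max (vcPayment C x u - rnPayment x u) 0) '' Set.Icc 0 v)
      ≤ p v - rnPayment x v := by
    refine csSup_le ((Set.nonempty_Icc.mpr hv).image _) ?_
    rintro _ ⟨u, ⟨hu0, huv⟩, rfl⟩
    refine max_le ?_ ?_
    · have h1 := hle u hu0
      have h2 := hmono u v hu0 huv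
      linarith
    · have h := hmono 0 v le_rfl hv
      have h0 : rnPayment x 0 = 0 := by simp [rnPayment]
      rw [hp.1, h0] at h
      linarith
  unfold capPayment
  linarith

/-! ### The two mechanisms -/

open Classical in
/-- Serve the agent with the largest score `s i (v i)` if that score is positive (ties go to the
smallest index), and nobody otherwise. -/
def scoreAlloc {n : ℕ} (s : Fin n → ℝ → EReal) (v : Fin n → ℝ) (i : Fin n) : ℝ :=
  if 0 < s i (v i) ∧ (∀ j, s j (v j) ≤ s i (v i)) ∧ ∀ j, j < i → s j (v j) < s i (v i)
  then 1 else 0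

/-- The interim allocation rule of agent `i`: her probability of being served when she reports `z`
and the others report their values. -/
def interimAlloc {n : ℕ} (μ : Fin n → Measure ℝ) (a : (Fin n → ℝ) → Fin n → ℝ) (i : Fin n)
    (z : ℝ) : ℝ :=
  ∫ v, a (Function.update v i z) i ∂(Measure.pi μ)

/-- The deterministic one-priced mechanism with allocation rule `a` given by the payment identity:
with interim allocation rule `x i`, a winner with report `z` is charged
`capPayment (C i) (x i) z / x i z`, and losers pay zero. -/
def paymentIdentityMechanism {n : ℕ} (μ : Fin n → Measure ℝ) (C : Fin n → ℝ)
    (a : (Fin n → ℝ) → Fin n → ℝ) : Mechanism n Unit where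
  seed := Measure.dirac ()
  alloc := fun _ v i => a v i
  pay := fun _ v i =>
    a v i * (capPayment (C i) (interimAlloc μ a i) (v i) / interimAlloc μ a i (v i))

/-- The payment-identity mechanism for the risk-neutral optimal allocation: serve the agent with the
largest positive virtual value. -/
def virtualSurplusMechanism {n : ℕ} (μ : Fin n → Measure ℝ) (f : Fin n → ℝ → ℝ) (C : Fin n → ℝ) :
    Mechanism n Unit :=
  paymentIdentityMechanism μ C (scoreAlloc fun i v => virtualValue (μ i) (f i) v)

/-- The payment-identity mechanism for the allocation that serves the agent with the largest
positive value minus capacity. -/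
def valueMinusCapacityMechanism {n : ℕ} (μ : Fin n → Measure ℝ) (C : Fin n → ℝ) :
    Mechanism n Unit :=
  paymentIdentityMechanism μ C (scoreAlloc fun i v => ((v - C i : ℝ) : EReal))

end CapacitatedAuction

end

open MeasureTheory

noncomputable section

namespace CapacitatedAuction

/-! ### Resampling one coordinate of a product measure -/

section Resample

variable {n : ℕ} {Ω : Type*} [MeasurableSpace Ω]

/-! The bound is `2A + B`, where `A` is the largest expected positive virtual value and `B` the
largest expected positive part of value minus capacity over feasible allocations. The first
mechanism earns at least `A` and the second at least `B`, so the better one earns at least a third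
of `2A + B`.

The heart is a single-agent estimate. Let `x` be the interim allocation and `U` the truthful capped
utility in a BIC auction. Since capped utility is concave, an agent whose value rises while her
report stays fixed gains at rate at least `g = x - U / C` over a stretch of length `C`
(`capUtility_add_le`, `Mechanism.IsAuction.interimIC`). Hence `∫ g ≤ U`, and `g` at any lower value
is at most `x` (`integral_valuePart_le`, `valuePart_le`). With `X` the running supremum of `g`, put
`Y(v) = g(v) + (∫_0^v g) / C + (min v C / C) X(v)`. The first two terms sum to at most `x`, and so
does the third, whence `Y ≤ 2x`. Moreover `v x - U`, an upper bound for the expected payment, is at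
most the risk-neutral payment of `Y` plus `(v - C)⁺ x` (`payment_le`).

In expectation a risk-neutral payment is a virtual surplus, an integration by parts that needs no
monotonicity of `Y`. So each agent pays at most twice her positive virtual surplus plus her surplus
above capacity (`integral_payment_le`). Summing over agents, the score-maximal allocations dominate
pointwise and give `2A + B`.

For the lower bounds, a monotone score makes the interim rule monotone; for virtual values this is
regularity. Then the payment identity is truthful (`utility_le_truthful`), and its payment dominates
both the risk-neutral payment, which yields `A`, and `(v - C) x`, which yields `B`. If some value
has infinite mean, the second mechanism has infinite revenue and nothing remains to be shown. -/

theorem measurable_update_prod (i : Fin n) :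
    Measurable fun p : ℝ × (Fin n → ℝ) => Function.update p.2 i p.1 := by
  refine measurable_pi_lambda _ fun j => ?_
  by_cases h : j = i
  · subst h; simpa using measurable_fst
  · simpa [Function.update_of_ne h, Function.comp_def] using
      (measurable_pi_apply (X := fun _ : Fin n => ℝ) j).comp (measurable_snd (α := ℝ))

/-- Redrawing one coordinate independently does not change a product law. This is what converts
expectations over the full profile into integrals of interim quantities, in which a report
overwrites the agent's own coordinate. -/
theorem measurePreserving_update (μ : Fin n → Measure ℝ) [∀ i, IsProbabilityMeasure (μ i)]
    (i : Fin n) :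
    MeasurePreserving (fun p : ℝ × (Fin n → ℝ) => Function.update p.2 i p.1)
      ((μ i).prod (Measure.pi μ)) (Measure.pi μ) := by
  refine ⟨measurable_update_prod i, Eq.symm (Measure.pi_eq fun s hs => ?_)⟩
  rw [Measure.map_apply (measurable_update_prod i) (MeasurableSet.univ_pi hs)]
  have : (fun p : ℝ × (Fin n → ℝ) => Function.update p.2 i p.1) ⁻¹' Set.univ.pi s
      = s i ×ˢ Set.univ.pi (Function.update s i Set.univ) := by
    ext p
    simp only [Set.mem_preimage, Set.mem_pi, Set.mem_univ, true_implies, Set.mem_prod]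
    constructor
    · intro h
      refine ⟨by simpa using h i, fun j => ?_⟩
      by_cases hj : j = i
      · subst hj; simp
      · simpa [Function.update_of_ne hj] using h j
    · rintro ⟨h, h'⟩ j
      by_cases hj : j = i
      · subst hj; simpa using h
      · simpa [Function.update_of_ne hj] using h' j
  rw [this, Measure.prod_prod, Measure.pi_pi, ← Finset.mul_prod_erase Finset.univ _
    (Finset.mem_univ i), ← Finset.mul_prod_erase Finset.univ (fun j => μ j (s j))
    (Finset.mem_univ i)]
  simp only [Function.update_self, measure_univ, one_mul]
  congr 1
  refine Finset.prod_congr rfl fun j hj => ?_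
  rw [Function.update_of_ne (Finset.ne_of_mem_erase hj)]

theorem measurePreserving_seed_update (ν : Measure Ω) [IsProbabilityMeasure ν]
    (μ : Fin n → Measure ℝ) [∀ i, IsProbabilityMeasure (μ i)] (i : Fin n) :
    MeasurePreserving
      (fun p : ℝ × (Ω × (Fin n → ℝ)) => (p.2.1, Function.update p.2.2 i p.1))
      ((μ i).prod (ν.prod (Measure.pi μ))) (ν.prod (Measure.pi μ)) := by
  have h1 : MeasurePreserving (fun p : ℝ × (Ω × (Fin n → ℝ)) => (p.2.1, (p.1, p.2.2)))
      ((μ i).prod (ν.prod (Measure.pi μ))) (ν.prod ((μ i).prod (Measure.pi μ))) := by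
    have a := (measurePreserving_prodAssoc (μ i) ν (Measure.pi μ)).symm
    have b := (Measure.measurePreserving_swap (μ := μ i) (ν := ν)).prod
      (MeasurePreserving.id (Measure.pi μ))
    have c := measurePreserving_prodAssoc ν (μ i) (Measure.pi μ)
    exact c.comp (b.comp a)
  exact ((MeasurePreserving.id ν).prod (measurePreserving_update μ i)).comp h1

theorem integral_resample (ν : Measure Ω) [IsProbabilityMeasure ν]
    (μ : Fin n → Measure ℝ) [∀ i, IsProbabilityMeasure (μ i)] (i : Fin n)
    {g : Ω × (Fin n → ℝ) → ℝ} (hg : Integrable g (ν.prod (Measure.pi μ))) :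
    ∫ p, g p ∂(ν.prod (Measure.pi μ))
      = ∫ z, ∫ p, g (p.1, Function.update p.2 i z) ∂(ν.prod (Measure.pi μ)) ∂(μ i) := by
  have h := measurePreserving_seed_update ν μ i
  conv_lhs => rw [← h.map_eq]
  rw [integral_map h.measurable.aemeasurable (by rw [h.map_eq]; exact hg.aestronglyMeasurable)]
  exact integral_prod _ (h.integrable_comp_of_integrable hg)

theorem lintegral_resample (ν : Measure Ω) [IsProbabilityMeasure ν]
    (μ : Fin n → Measure ℝ) [∀ i, IsProbabilityMeasure (μ i)] (i : Fin n)
    {g : Ω × (Fin n → ℝ) → ENNReal} (hg : Measurable g) :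
    ∫⁻ p, g p ∂(ν.prod (Measure.pi μ))
      = ∫⁻ z, ∫⁻ p, g (p.1, Function.update p.2 i z) ∂(ν.prod (Measure.pi μ)) ∂(μ i) := by
  have h := measurePreserving_seed_update ν μ i
  rw [← h.lintegral_comp hg]
  exact lintegral_prod _ (hg.comp h.measurable).aemeasurable

end Resample

/-! ### Densities and the expected risk-neutral payment -/

namespace IsDensity

variable {μ : Measure ℝ} {f : ℝ → ℝ}

theorem nullSingletonClass (hf : IsDensity μ f) : NullSingletonClass μ := by
  rw [hf.eq_withDensity]; infer_instance

theorem eq_restrict_withDensity (hf : IsDensity μ f) (h0 : μ (Set.Iio 0) = 0) :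
    μ = (volume.restrict (Set.Ioi 0)).withDensity fun v => ENNReal.ofReal (f v) := by
  have := hf.nullSingletonClass
  rw [← restrict_withDensity measurableSet_Ioi, ← hf.eq_withDensity]
  refine (Measure.restrict_eq_self_of_ae_mem ?_).symm
  rw [ae_iff]
  have : {a : ℝ | a ∉ Set.Ioi 0} = Set.Iic 0 := by ext; simp
  rw [this, ← Iio_ae_eq_Iic.measure_eq, h0]

theorem integrable_iff (hf : IsDensity μ f) (h0 : μ (Set.Iio 0) = 0) {h : ℝ → ℝ} :
    Integrable h μ ↔ IntegrableOn (fun v => f v * h v) (Set.Ioi 0) := by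
  conv_lhs => rw [hf.eq_restrict_withDensity h0]
  rw [integrable_withDensity_iff_integrable_smul' hf.measurable.ennreal_ofReal (by simp)]
  simp [ENNReal.toReal_ofReal (hf.nonneg _), IntegrableOn]

theorem integral_eq (hf : IsDensity μ f) (h0 : μ (Set.Iio 0) = 0) (h : ℝ → ℝ) :
    ∫ v, h v ∂μ = ∫ v in Set.Ioi 0, f v * h v := by
  conv_lhs => rw [hf.eq_restrict_withDensity h0]
  rw [integral_withDensity_eq_integral_toReal_smul hf.measurable.ennreal_ofReal (by simp)]
  simp [ENNReal.toReal_ofReal (hf.nonneg _)]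

theorem measure_Ici [IsProbabilityMeasure μ] (hf : IsDensity μ f) (t : ℝ) :
    μ (Set.Ici t) = ENNReal.ofReal (1 - ProbabilityTheory.cdf μ t) := by
  have := hf.nullSingletonClass
  rw [← Ioi_ae_eq_Ici.measure_eq, ENNReal.ofReal_sub _ (ProbabilityTheory.cdf_nonneg μ t),
    ProbabilityTheory.ofReal_cdf, ENNReal.ofReal_one, ← Set.compl_Iic,
    prob_compl_eq_one_sub measurableSet_Iic]

end IsDensity

theorem intervalIntegrable_of_bounded {Y : ℝ → ℝ} {K : ℝ} (hYm : Measurable Y)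
    (h0 : ∀ v, 0 ≤ Y v) (hK : ∀ v, Y v ≤ K) (a b : ℝ) : IntervalIntegrable Y volume a b := by
  rw [intervalIntegrable_iff]
  refine Measure.integrableOn_of_bounded (M := K) (by simp) hYm.aestronglyMeasurable
    (ae_of_all _ fun v => ?_)
  rw [Real.norm_eq_abs, abs_of_nonneg (h0 v)]
  exact hK v

theorem continuous_primitive_of_bounded {Y : ℝ → ℝ} {K : ℝ} (hYm : Measurable Y)
    (h0 : ∀ v, 0 ≤ Y v) (hK : ∀ v, Y v ≤ K) : Continuous fun v => ∫ z in (0 : ℝ)..v, Y z :=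
  intervalIntegral.continuous_primitive
    (fun a b => intervalIntegrable_of_bounded hYm h0 hK a b) 0

theorem primitive_le_mul {Y : ℝ → ℝ} {K : ℝ} (hYm : Measurable Y)
    (h0 : ∀ v, 0 ≤ Y v) (hK : ∀ v, Y v ≤ K) {v : ℝ} (hv : 0 ≤ v) :
    ∫ z in (0 : ℝ)..v, Y z ≤ K * v := by
  have := intervalIntegral.integral_mono hv (intervalIntegrable_of_bounded hYm h0 hK 0 v)
    (intervalIntegrable_const (c := K)) hK
  simpa [mul_comm] using this

section RiskNeutral

variable {μ : Measure ℝ} {f : ℝ → ℝ} [IsProbabilityMeasure μ]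

/-- Integration by parts: the expected risk-neutral payment is the expected virtual surplus. -/
theorem integral_rnPayment (hf : IsDensity μ f) (hμ : μ (Set.Iio 0) = 0)
    (hid : Integrable id μ) {Y : ℝ → ℝ} {K : ℝ} (hYm : Measurable Y)
    (h0 : ∀ v, 0 ≤ Y v) (hK : ∀ v, Y v ≤ K) :
    Integrable (rnPayment Y) μ ∧
    IntegrableOn (fun v => (v * f v - (1 - ProbabilityTheory.cdf μ v)) * Y v) (Set.Ioi 0) ∧
    ∫ v, rnPayment Y v ∂μ
      = ∫ v in Set.Ioi 0, (v * f v - (1 - ProbabilityTheory.cdf μ v)) * Y v := by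
  have hnn : ∀ᵐ v ∂μ, 0 ≤ v := by
    rw [ae_iff]; simpa [Set.Iio] using hμ
  have hprim : Continuous fun v => ∫ z in (0 : ℝ)..v, Y z :=
    continuous_primitive_of_bounded hYm h0 hK
  have hI1 : Integrable (fun v => v * Y v) μ := by
    refine (hid.mul_const K).mono' (measurable_id.mul hYm).aestronglyMeasurable ?_
    filter_upwards [hnn] with v hv
    rw [Real.norm_eq_abs, abs_of_nonneg (mul_nonneg hv (h0 v))]
    exact mul_le_mul_of_nonneg_left (hK v) hv
  have hpnn : ∀ᵐ v ∂μ, 0 ≤ ∫ z in (0 : ℝ)..v, Y z := by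
    filter_upwards [hnn] with v hv
    exact intervalIntegral.integral_nonneg hv fun z _ => h0 z
  have hI2 : Integrable (fun v => ∫ z in (0 : ℝ)..v, Y z) μ := by
    refine (hid.const_mul K).mono' hprim.aestronglyMeasurable ?_
    filter_upwards [hnn, hpnn] with v hv hv'
    rw [Real.norm_eq_abs, abs_of_nonneg hv']
    exact primitive_le_mul hYm h0 hK hv
  have hlc : ∫⁻ v, ENNReal.ofReal (∫ z in (0 : ℝ)..v, Y z) ∂μ
      = ∫⁻ t in Set.Ioi 0, ENNReal.ofReal ((1 - ProbabilityTheory.cdf μ t) * Y t) := by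
    -- Layer-cake formula: swapping the order of integration turns the primitive of `Y` into `Y`
    -- weighted by the tail probability.
    have := lintegral_comp_eq_lintegral_meas_le_mul (f := id) (g := Y) μ hnn
      measurable_id.aemeasurable (fun t _ => intervalIntegrable_of_bounded hYm h0 hK 0 t)
      (ae_of_all _ h0)
    simp only [id] at this
    rw [this]
    refine lintegral_congr fun t => ?_
    rw [ENNReal.ofReal_mul (by linarith [ProbabilityTheory.cdf_le_one μ t]), ← hf.measure_Ici]
    rfl
  have htail : ∀ t, 0 ≤ (1 - ProbabilityTheory.cdf μ t) * Y t := fun t =>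
    mul_nonneg (by linarith [ProbabilityTheory.cdf_le_one μ t]) (h0 t)
  have htm : Measurable fun t => (1 - ProbabilityTheory.cdf μ t) * Y t :=
    (measurable_const.sub (ProbabilityTheory.monotone_cdf μ).measurable).mul hYm
  have hI3 : IntegrableOn (fun t => (1 - ProbabilityTheory.cdf μ t) * Y t) (Set.Ioi 0) := by
    refine ⟨htm.aestronglyMeasurable, ?_⟩
    rw [hasFiniteIntegral_iff_ofReal (ae_of_all _ htail), ← hlc,
      ← hasFiniteIntegral_iff_ofReal hpnn]
    exact hI2.2
  have h2 : ∫ v, (∫ z in (0 : ℝ)..v, Y z) ∂μ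
      = ∫ t in Set.Ioi 0, (1 - ProbabilityTheory.cdf μ t) * Y t := by
    rw [integral_eq_lintegral_of_nonneg_ae hpnn hprim.aestronglyMeasurable, hlc,
      ← integral_eq_lintegral_of_nonneg_ae (ae_of_all _ htail) htm.aestronglyMeasurable]
  have hI1' := (hf.integrable_iff hμ).1 hI1
  have hsplit : (fun v => (v * f v - (1 - ProbabilityTheory.cdf μ v)) * Y v)
      = fun v => f v * (v * Y v) - (1 - ProbabilityTheory.cdf μ v) * Y v := by
    funext v; ring
  refine ⟨hI1.sub hI2, ?_, ?_⟩
  · rw [hsplit]; exact hI1'.sub hI3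
  · rw [hsplit, integral_sub hI1' hI3, ← h2, ← hf.integral_eq hμ]
    exact integral_sub hI1 hI2

end RiskNeutral

/-! ### Single-agent consequences of incentive compatibility -/

/-- The consequences of incentive compatibility for the interim allocation `x` and the truthful
utility `U` of an agent with capacity `C` and value space `V`. -/
structure InterimIC (C : ℝ) (V : Set ℝ) (x U : ℝ → ℝ) : Prop where
  nonneg : ∀ v ∈ V, 0 ≤ U v
  le_mul : ∀ v ∈ V, U v ≤ C * x v
  le_one : ∀ v ∈ V, x v ≤ 1
  upward : ∀ v ∈ V, ∀ w ∈ V, v ≤ w → U v + min (w - v) C * (x v - U v / C) ≤ U w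
  downward : ∀ v ∈ V, ∀ w ∈ V, v ≤ w → U w - U v ≤ (w - v) * x w

/-- The part of the interim allocation that is not accounted for by wealth at full capacity. -/
def valuePart (C : ℝ) (V : Set ℝ) (x U : ℝ → ℝ) : ℝ → ℝ := V.indicator fun v => x v - U v / C

/-- The running supremum of a function. -/
def runningSup (g : ℝ → ℝ) (v : ℝ) : ℝ := sSup (g '' Set.Iic v)

section RunningSup

variable {g : ℝ → ℝ}

theorem bddAbove_image_of_le_one (h1 : ∀ v, g v ≤ 1) (s : Set ℝ) : BddAbove (g '' s) :=
  ⟨1, by rintro _ ⟨u, _, rfl⟩; exact h1 u⟩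

theorem le_runningSup (h1 : ∀ v, g v ≤ 1) {u v : ℝ} (h : u ≤ v) : g u ≤ runningSup g v :=
  le_csSup (bddAbove_image_of_le_one h1 _) (Set.mem_image_of_mem _ h)

theorem runningSup_le {v b : ℝ} (h : ∀ u ≤ v, g u ≤ b) : runningSup g v ≤ b :=
  csSup_le (Set.nonempty_Iic.image _) (by rintro _ ⟨u, hu, rfl⟩; exact h u hu)

theorem monotone_runningSup (h1 : ∀ v, g v ≤ 1) : Monotone (runningSup g) := fun _ _ h =>
  runningSup_le fun _ hu => le_runningSup h1 (hu.trans h)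

end RunningSup

/-! ### Growth of the truthful utility -/

namespace InterimIC

variable {C : ℝ} {V : Set ℝ} {x U : ℝ → ℝ}

theorem alloc_nonneg (h : InterimIC C V x U) (hC : 0 < C) {v : ℝ} (hv : v ∈ V) : 0 ≤ x v :=
  nonneg_of_mul_nonneg_right ((h.nonneg v hv).trans (h.le_mul v hv)) hC

theorem valuePart_nonneg (h : InterimIC C V x U) (hC : 0 < C) (v : ℝ) :
    0 ≤ valuePart C V x U v := by
  refine Set.indicator_nonneg (fun v hv => ?_) v
  rw [sub_nonneg, div_le_iff₀ hC, mul_comm]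
  exact h.le_mul v hv

theorem valuePart_le_one (h : InterimIC C V x U) (hC : 0 < C) (v : ℝ) :
    valuePart C V x U v ≤ 1 := by
  refine Set.indicator_le' (fun v hv => ?_) (fun _ _ => zero_le_one) v
  have := div_nonneg (h.nonneg v hv) hC.le
  have := h.le_one v hv
  linarith

theorem measurable_valuePart (hV : V.OrdConnected) (hx : Measurable x) (hU : Measurable U) :
    Measurable (valuePart C V x U) :=
  (hx.sub (hU.div_const C)).indicator hV.measurableSet

theorem utility_monotone (h : InterimIC C V x U) (hC : 0 < C) {v w : ℝ} (hv : v ∈ V)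
    (hw : w ∈ V) (hvw : v ≤ w) : U v ≤ U w := by
  have h1 := h.upward v hv w hw hvw
  have h2 := h.valuePart_nonneg hC v
  rw [valuePart, Set.indicator_of_mem hv] at h2
  have := mul_nonneg (le_min (sub_nonneg.2 hvw) hC.le) h2
  linarith

/-- The utility gain from `s` to `w` is squeezed between a lower bound with slope `valuePart` at `s`
and an upper bound in terms of `x w`. No monotonicity of `x` is available, and this comparison takes
its place. -/
theorem valuePart_le (h : InterimIC C V x U) (hC : 0 < C) {s w : ℝ} (hw : w ∈ V)
    (hsw : s ≤ w) : valuePart C V x U s ≤ x w := by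
  by_cases hs : s ∈ V
  swap
  · rw [valuePart, Set.indicator_of_notMem hs]; exact h.alloc_nonneg hC hw
  rw [valuePart, Set.indicator_of_mem hs]
  have hU := h.nonneg s hs
  rcases hsw.eq_or_lt with rfl | hlt
  · have := div_nonneg hU hC.le
    linarith
  have h1 := h.upward s hs w hw hsw
  -- For gaps up to `C` the upper bound is the downward constraint. Beyond `C` the lower bound is
  -- capped, and `U w ≤ C * x w` serves instead.
  rcases le_total (w - s) C with hle | hle
  · rw [min_eq_left hle] at h1
    have h2 := h.downward s hs w hw hsw
    exact le_of_mul_le_mul_left (by linarith) (sub_pos.2 hlt)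
  · rw [min_eq_right hle] at h1
    have h2 := h.le_mul w hw
    exact le_of_mul_le_mul_left (by linarith) hC

/-- The upward constraint as a difference inequality on the whole line below `v`. Extending by zero
is harmless: below `V` the left side vanishes and the extended utility can only jump up, and
order-connectedness rules out leaving `V` before `v`. -/
theorem mul_valuePart_le (h : InterimIC C V x U) (hV : V.OrdConnected) {v s t : ℝ}
    (hv : v ∈ V) (ht0 : 0 ≤ t) (htC : t ≤ C) (hs : s + t ≤ v) :
    t * valuePart C V x U s ≤ V.indicator U (s + t) - V.indicator U s := by
  by_cases hsV : s ∈ V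
  · have hstV : s + t ∈ V := hV.out hsV hv ⟨by linarith, hs⟩
    rw [valuePart, Set.indicator_of_mem hsV, Set.indicator_of_mem hsV, Set.indicator_of_mem hstV]
    have h1 := h.upward s hsV (s + t) hstV (by linarith)
    rw [add_sub_cancel_left, min_eq_left htC] at h1
    linarith
  · rw [valuePart, Set.indicator_of_notMem hsV, Set.indicator_of_notMem hsV]
    have := Set.indicator_nonneg h.nonneg (s + t)
    simpa using this

theorem indicator_le (h : InterimIC C V x U) (hC : 0 < C) {v s : ℝ}
    (hv : v ∈ V) (hs : s ≤ v) : V.indicator U s ≤ U v := by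
  by_cases hsV : s ∈ V
  · rw [Set.indicator_of_mem hsV]; exact h.utility_monotone hC hsV hv hs
  · rw [Set.indicator_of_notMem hsV]; exact h.nonneg v hv

/-- Utility is at least the integral of `valuePart`. -/
theorem integral_valuePart_le (h : InterimIC C V x U) (hV : V.OrdConnected)
    (hx : Measurable x) (hU : Measurable U) (hC : 0 < C) {v : ℝ} (hv : v ∈ V) (hv0 : 0 ≤ v) :
    ∫ z in (0 : ℝ)..v, valuePart C V x U z ≤ U v := by
  rcases hv0.eq_or_lt with rfl | hvpos
  · simpa using h.nonneg 0 hv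
  set g := valuePart C V x U with hg
  have gm : Measurable g := measurable_valuePart hV hx hU
  have gi := intervalIntegrable_of_bounded gm (h.valuePart_nonneg hC) (h.valuePart_le_one hC)
  have um : Measurable (V.indicator U) := hU.indicator hV.measurableSet
  have u0 : ∀ s, 0 ≤ V.indicator U s := Set.indicator_nonneg h.nonneg
  have uC : ∀ s, V.indicator U s ≤ C := fun s => by
    refine Set.indicator_le' (fun s hs => ?_) (fun _ _ => hC.le) s
    exact (h.le_mul s hs).trans (mul_le_of_le_one_right hC.le (h.le_one s hs))
  have ui := intervalIntegrable_of_bounded um u0 uC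
  have key : ∀ t, 0 < t → t < min C v → ∫ z in (0 : ℝ)..(v - t), g z ≤ U v := by
    intro t ht htm
    have htC : t ≤ C := (htm.trans_le (min_le_left _ _)).le
    have htv : t ≤ v := (htm.trans_le (min_le_right _ _)).le
    have hshift : IntervalIntegrable (fun s => V.indicator U (s + t)) volume 0 (v - t) :=
      intervalIntegrable_of_bounded (um.comp (measurable_id.add_const t)) (fun s => u0 (s + t))
        (fun s => uC (s + t)) _ _
    have h1 : ∫ z in (0 : ℝ)..(v - t), t * g z
        ≤ ∫ z in (0 : ℝ)..(v - t), (V.indicator U (z + t) - V.indicator U z) := by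
      refine intervalIntegral.integral_mono_on (by linarith) ((gi _ _).const_mul t)
        (hshift.sub (ui _ _)) fun s hs => ?_
      exact h.mul_valuePart_le hV hv ht.le htC (by linarith [hs.2])
    rw [intervalIntegral.integral_const_mul, intervalIntegral.integral_sub hshift (ui _ _),
      intervalIntegral.integral_comp_add_right (fun s => V.indicator U s), zero_add,
      sub_add_cancel] at h1
    have h2 := intervalIntegral.integral_add_adjacent_intervals (ui 0 t) (ui t v)
    have h3 := intervalIntegral.integral_add_adjacent_intervals (ui 0 (v - t)) (ui (v - t) v)
    have h4 : 0 ≤ ∫ z in (0 : ℝ)..t, V.indicator U z :=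
      intervalIntegral.integral_nonneg ht.le fun z _ => u0 z
    have h5 : ∫ z in (v - t)..v, V.indicator U z ≤ ∫ _ in (v - t)..v, U v :=
      intervalIntegral.integral_mono_on (by linarith) (ui _ _) intervalIntegrable_const
        fun s hs => h.indicator_le hC hv hs.2
    rw [intervalIntegral.integral_const, smul_eq_mul, sub_sub_cancel] at h5
    exact le_of_mul_le_mul_left (by linarith) ht
  have hcont : Continuous fun t => ∫ z in (0 : ℝ)..(v - t), g z :=
    (continuous_primitive_of_bounded gm (h.valuePart_nonneg hC) (h.valuePart_le_one hC)).comp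
      (continuous_const.sub continuous_id)
  have hlim := (hcont.tendsto 0).mono_left
    (nhdsWithin_le_nhds (s := Set.Ioi (0 : ℝ)))
  rw [sub_zero] at hlim
  refine le_of_tendsto hlim ?_
  filter_upwards [Ioo_mem_nhdsGT (lt_min hC hvpos)] with t ht
  exact key t ht.1 ht.2

end InterimIC

/-- A feasible allocation rule, at most twice the given one, whose risk-neutral payment bounds the
payments of the agent up to her value minus her capacity. -/
def majorant (C : ℝ) (V : Set ℝ) (x U : ℝ → ℝ) : ℝ → ℝ :=
  V.indicator fun v => valuePart C V x U v + (∫ z in (0 : ℝ)..v, valuePart C V x U z) / C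
    + min v C / C * runningSup (valuePart C V x U) v

/-! ### The majorant and the bound on payments -/

namespace InterimIC

variable {C : ℝ} {V : Set ℝ} {x U : ℝ → ℝ}

theorem measurable_majorant (h : InterimIC C V x U) (hV : V.OrdConnected) (hx : Measurable x)
    (hU : Measurable U) (hC : 0 < C) : Measurable (majorant C V x U) := by
  have gm : Measurable (valuePart C V x U) := measurable_valuePart hV hx hU
  refine Measurable.indicator ?_ hV.measurableSet
  refine (gm.add (Measurable.div_const ?_ C)).add
    (((measurable_id.min measurable_const).div_const C).mul
      (monotone_runningSup (h.valuePart_le_one hC)).measurable)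
  exact (continuous_primitive_of_bounded gm (h.valuePart_nonneg hC)
    (h.valuePart_le_one hC)).measurable

theorem runningSup_nonneg (h : InterimIC C V x U) (hC : 0 < C) (v : ℝ) :
    0 ≤ runningSup (valuePart C V x U) v :=
  (h.valuePart_nonneg hC v).trans (le_runningSup (h.valuePart_le_one hC) le_rfl)

theorem majorant_nonneg (h : InterimIC C V x U) (hV0 : V ⊆ Set.Ici 0) (hC : 0 < C) (v : ℝ) :
    0 ≤ majorant C V x U v := by
  refine Set.indicator_nonneg (fun v hv => ?_) v
  have hv0 : 0 ≤ v := hV0 hv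
  have h1 := h.valuePart_nonneg hC v
  have h2 : 0 ≤ ∫ z in (0 : ℝ)..v, valuePart C V x U z :=
    intervalIntegral.integral_nonneg hv0 fun z _ => h.valuePart_nonneg hC z
  have h3 := h.runningSup_nonneg hC v
  have h4 : 0 ≤ min v C := le_min hv0 hC.le
  positivity

/-- Replacing the integral of `valuePart` by `U v` bounds the first two terms by `x v - U v / C + U
v / C = x v`. The running supremum accounts for the second `x v`. -/
theorem majorant_le (h : InterimIC C V x U) (hV0 : V ⊆ Set.Ici 0) (hV : V.OrdConnected)
    (hx : Measurable x) (hU : Measurable U) (hC : 0 < C) {v : ℝ} (hv : v ∈ V) :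
    majorant C V x U v ≤ 2 * x v := by
  rw [majorant, Set.indicator_of_mem hv]
  have h1 := div_le_div_of_nonneg_right (h.integral_valuePart_le hV hx hU hC hv (hV0 hv)) hC.le
  have h2 : runningSup (valuePart C V x U) v ≤ x v :=
    runningSup_le fun u hu => h.valuePart_le hC hv hu
  have h3 : min v C / C ≤ 1 := (div_le_one hC).2 (min_le_right _ _)
  have h4 := mul_le_of_le_one_left (h.runningSup_nonneg hC v) h3
  have h5 : valuePart C V x U v = x v - U v / C := Set.indicator_of_mem hv _
  linarith

theorem majorant_le_two (h : InterimIC C V x U) (hV0 : V ⊆ Set.Ici 0) (hV : V.OrdConnected)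
    (hx : Measurable x) (hU : Measurable U) (hC : 0 < C) (v : ℝ) :
    majorant C V x U v ≤ 2 := by
  by_cases hv : v ∈ V
  · have := h.majorant_le hV0 hV hx hU hC hv
    have := h.le_one v hv
    linarith
  · rw [majorant, Set.indicator_of_notMem hv]; exact zero_le_two

/-- A bound for the majorant below `v` in terms of data at `v`. -/
theorem majorant_le_of_le (h : InterimIC C V x U) (hV : V.OrdConnected)
    (hx : Measurable x) (hU : Measurable U) (hC : 0 < C) {u v : ℝ}
    (hu : 0 ≤ u) (huv : u ≤ v) :
    majorant C V x U u ≤ valuePart C V x U u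
      + min (u * runningSup (valuePart C V x U) v) (∫ z in (0 : ℝ)..v, valuePart C V x U z) / C
      + min u C / C * runningSup (valuePart C V x U) v := by
  have gm : Measurable (valuePart C V x U) := measurable_valuePart hV hx hU
  have gi := intervalIntegrable_of_bounded gm (h.valuePart_nonneg hC) (h.valuePart_le_one hC)
  have hS0 : ∀ a b, a ≤ b → 0 ≤ ∫ z in a..b, valuePart C V x U z := fun a b hab =>
    intervalIntegral.integral_nonneg hab fun z _ => h.valuePart_nonneg hC z
  have hX0 := h.runningSup_nonneg hC v
  have hm0 : 0 ≤ min u C := le_min hu hC.le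
  by_cases huV : u ∈ V
  · rw [majorant, Set.indicator_of_mem huV]
    -- Both bounds on this integral are kept: `payment_le` uses the one linear in `u` up to the
    -- capacity and the constant one above it.
    have h1 : ∫ z in (0 : ℝ)..u, valuePart C V x U z ≤ u * runningSup (valuePart C V x U) v := by
      have := intervalIntegral.integral_mono_on hu (gi 0 u)
        (intervalIntegrable_const (c := runningSup (valuePart C V x U) v)) fun z hz =>
          le_runningSup (h.valuePart_le_one hC) (hz.2.trans huv)
      simpa using this
    have h2 : ∫ z in (0 : ℝ)..u, valuePart C V x U z
        ≤ ∫ z in (0 : ℝ)..v, valuePart C V x U z := by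
      have := intervalIntegral.integral_add_adjacent_intervals (gi 0 u) (gi u v)
      have := hS0 u v huv
      linarith
    have h3 := monotone_runningSup (h.valuePart_le_one hC) huv
    gcongr
    exact le_min h1 h2
  · rw [majorant, Set.indicator_of_notMem huV]
    have h1 := h.valuePart_nonneg hC u
    have h2 : 0 ≤ min (u * runningSup (valuePart C V x U) v)
        (∫ z in (0 : ℝ)..v, valuePart C V x U z) :=
      le_min (mul_nonneg hu hX0) (hS0 0 v (hu.trans huv))
    positivity

/-- The running-supremum term is tuned to this inequality: at `v` it contributes enough to `v * Y v`
to cover what the extra terms of the majorant `Y` cost in `∫ Y`. Below, `g` is the value part, `X`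
its running supremum at `v`, and `S` the integral of `g` up to `v`; the substitution `x v = g v + U
v / C` reduces the claim to `S ≤ U v` and `0 ≤ g v`. -/
theorem payment_le (h : InterimIC C V x U) (hV0 : V ⊆ Set.Ici 0) (hV : V.OrdConnected)
    (hx : Measurable x) (hU : Measurable U) (hC : 0 < C) {v : ℝ} (hv : v ∈ V) :
    v * x v - U v ≤ rnPayment (majorant C V x U) v + max (v - C) 0 * x v := by
  have hv0 : 0 ≤ v := hV0 hv
  have hSU := h.integral_valuePart_le hV hx hU hC hv hv0
  have gm : Measurable (valuePart C V x U) := measurable_valuePart hV hx hU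
  have gi := intervalIntegrable_of_bounded gm (h.valuePart_nonneg hC) (h.valuePart_le_one hC)
  have yi := intervalIntegrable_of_bounded (h.measurable_majorant hV hx hU hC)
    (h.majorant_nonneg hV0 hC) (h.majorant_le_two hV0 hV hx hU hC)
  have hY := fun u => h.majorant_le_of_le (u := u) (v := v) hV hx hU hC
  have hg : valuePart C V x U v = x v - U v / C := Set.indicator_of_mem hv _
  have hg0 := h.valuePart_nonneg hC v
  have hYv : majorant C V x U v = valuePart C V x U v
    + (∫ z in (0 : ℝ)..v, valuePart C V x U z) / C
    + min v C / C * runningSup (valuePart C V x U) v := Set.indicator_of_mem hv _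
  rw [rnPayment, hYv]
  generalize majorant C V x U = Y at *
  generalize runningSup (valuePart C V x U) v = X at *
  generalize valuePart C V x U = g at *
  -- Up to the capacity each extra term of the majorant is at most `u * X / C`; together they
  -- integrate to `b ^ 2 * (X / C)`.
  have hlin : ∀ b, 0 ≤ b → b ≤ v → b ≤ C →
      ∫ z in (0 : ℝ)..b, Y z ≤ (∫ z in (0 : ℝ)..b, g z) + b ^ 2 * (X / C) := by
    intro b hb hbv hbC
    have hi : IntervalIntegrable (fun u : ℝ => u * (2 * X / C)) volume 0 b :=
      (continuous_id.mul continuous_const).intervalIntegrable _ _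
    have h1 : ∫ z in (0 : ℝ)..b, Y z ≤ ∫ z in (0 : ℝ)..b, (g z + z * (2 * X / C)) := by
      refine intervalIntegral.integral_mono_on hb (yi _ _) ((gi _ _).add hi) fun u hu => ?_
      refine (hY u hu.1 (hu.2.trans hbv)).trans ?_
      rw [min_eq_left (hu.2.trans hbC)]
      have := div_le_div_of_nonneg_right (min_le_left (u * X) (∫ z in (0 : ℝ)..v, g z)) hC.le
      calc _ ≤ g u + u * X / C + u / C * X := by linarith
        _ = _ := by ring
    rw [intervalIntegral.integral_add (gi _ _) hi, intervalIntegral.integral_mul_const,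
      integral_id] at h1
    calc _ ≤ _ := h1
      _ = _ := by ring
  have hxv : x v = g v + U v / C := by linarith
  rcases le_total v C with hvC | hCv
  · have h1 := hlin v hv0 le_rfl hvC
    rw [min_eq_left hvC, max_eq_right (by linarith), hxv]
    -- The `X` terms cancel, leaving `v * g v - (1 - v / C) * S` as a lower bound for the
    -- risk-neutral payment. Since `v ≤ C`, replacing `S` by the larger `U v` goes in the right
    -- direction.
    have h2 : 0 ≤ (1 - v / C) * (U v - ∫ z in (0 : ℝ)..v, g z) :=
      mul_nonneg (by rw [sub_nonneg, div_le_one hC]; exact hvC) (by linarith)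
    have e : v / C * X = v * (X / C) := by ring
    rw [e]
    have e2 : v * (U v / C) = v / C * U v := by ring
    have e3 : v * ((∫ z in (0 : ℝ)..v, g z) / C) = v / C * ∫ z in (0 : ℝ)..v, g z := by ring
    nlinarith
  · have h1 := hlin C hC.le hCv le_rfl
    -- Above the capacity the extra terms are bounded by constants. All `X` and `S` terms then
    -- cancel, the risk-neutral payment is at least `v * g v`, and `(v - C) * x v` supplies the
    -- remaining `(v - C) * U v / C`.
    have h2 : ∫ z in C..v, Y z ≤ ∫ z in C..v, (g z + ((∫ z in (0 : ℝ)..v, g z) / C + X)) := by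
      refine intervalIntegral.integral_mono_on hCv (yi _ _)
        ((gi _ _).add intervalIntegrable_const) fun u hu => ?_
      refine (hY u (hC.le.trans hu.1) hu.2).trans ?_
      rw [min_eq_right hu.1, div_self hC.ne', one_mul]
      have := div_le_div_of_nonneg_right (min_le_right (u * X) (∫ z in (0 : ℝ)..v, g z)) hC.le
      linarith
    rw [intervalIntegral.integral_add (gi _ _) intervalIntegrable_const,
      intervalIntegral.integral_const, smul_eq_mul] at h2
    have h3 := intervalIntegral.integral_add_adjacent_intervals (yi 0 C) (yi C v)
    have h4 := intervalIntegral.integral_add_adjacent_intervals (gi 0 C) (gi C v)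
    rw [min_eq_right hCv, max_eq_left (by linarith), hxv, div_self hC.ne', one_mul]
    have h5 : 0 ≤ (v - C) * g v := mul_nonneg (by linarith) hg0
    have e : C ^ 2 * (X / C) = C * X := by field_simp
    have e2 : C * (U v / C) = U v := by field_simp
    have e3 : C * ((∫ z in (0 : ℝ)..v, g z) / C) = ∫ z in (0 : ℝ)..v, g z := by field_simp
    rw [e] at h1
    nlinarith

/-- The expected payment of an agent in an incentive compatible mechanism is at most twice her
positive virtual surplus plus her surplus above capacity. -/
theorem integral_payment_le (h : InterimIC C V x U) (hV0 : V ⊆ Set.Ici 0) (hV : V.OrdConnected)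
    (hx : Measurable x) (hU : Measurable U) (hC : 0 < C) {μ : Measure ℝ}
    [IsProbabilityMeasure μ] (hμV : μ Vᶜ = 0) {f : ℝ → ℝ} (hf : IsDensity μ f)
    (hid : Integrable id μ) {ψ : ℝ → ℝ} (hψi : Integrable ψ μ) (hψ0 : ∀ v, 0 ≤ ψ v)
    (hψ : ∀ v, 0 < f v → v - (1 - ProbabilityTheory.cdf μ v) / f v ≤ ψ v) :
    ∫ v, (v * x v - U v) ∂μ
      ≤ 2 * (∫ v, ψ v * x v ∂μ) + ∫ v, max (v - C) 0 * x v ∂μ := by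
  have haeV : ∀ᵐ v ∂μ, v ∈ V := hμV
  have hμ0 : μ (Set.Iio 0) = 0 :=
    measure_mono_null (t := Vᶜ) (fun v (hv : v < 0) hvV =>
      absurd (show (0 : ℝ) ≤ v from hV0 hvV) (not_le.2 hv)) hμV
  have hxb : ∀ᵐ v ∂μ, ‖x v‖ ≤ 1 := by
    filter_upwards [haeV] with v hv
    rw [Real.norm_eq_abs, abs_of_nonneg (h.alloc_nonneg hC hv)]
    exact h.le_one v hv
  have i1 : Integrable (fun v => v * x v) μ := hid.mul_bdd hx.aestronglyMeasurable hxb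
  have i2 : Integrable U μ := by
    refine Integrable.of_bound hU.aestronglyMeasurable C ?_
    filter_upwards [haeV] with v hv
    rw [Real.norm_eq_abs, abs_of_nonneg (h.nonneg v hv)]
    exact (h.le_mul v hv).trans (mul_le_of_le_one_right hC.le (h.le_one v hv))
  have i3 : Integrable (fun v => ψ v * x v) μ := hψi.mul_bdd hx.aestronglyMeasurable hxb
  have i4 : Integrable (fun v => max (v - C) 0 * x v) μ :=
    ((hid.sub (integrable_const C)).pos_part).mul_bdd hx.aestronglyMeasurable hxb
  have ym := h.measurable_majorant hV hx hU hC
  have y0 := h.majorant_nonneg hV0 hC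
  have y2 := h.majorant_le_two hV0 hV hx hU hC
  obtain ⟨r1, r2, r3⟩ := integral_rnPayment hf hμ0 hid ym y0 y2
  have i5 : Integrable (fun v => ψ v * majorant C V x U v) μ :=
    hψi.mul_bdd (c := 2) ym.aestronglyMeasurable (ae_of_all _ fun v => by
      rw [Real.norm_eq_abs, abs_of_nonneg (y0 v)]; exact y2 v)
  have s1 : ∫ v, (v * x v - U v) ∂μ
      ≤ ∫ v, (rnPayment (majorant C V x U) v + max (v - C) 0 * x v) ∂μ := by
    refine integral_mono_ae (i1.sub i2) (r1.add i4) ?_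
    filter_upwards [haeV] with v hv
    exact h.payment_le hV0 hV hx hU hC hv
  have s2 : ∫ v, rnPayment (majorant C V x U) v ∂μ ≤ ∫ v, ψ v * majorant C V x U v ∂μ := by
    rw [r3, hf.integral_eq hμ0]
    refine integral_mono r2 ((hf.integrable_iff hμ0).1 i5) fun v => ?_
    dsimp only
    rw [← mul_assoc]
    refine mul_le_mul_of_nonneg_right ?_ (y0 v)
    -- Where the density vanishes, the integrand on the left is minus the tail probability times the
    -- majorant, hence nonpositive.
    rcases (hf.nonneg v).eq_or_lt with h0 | hpos
    · rw [← h0]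
      linarith [ProbabilityTheory.cdf_le_one μ v]
    · have := mul_le_mul_of_nonneg_left (hψ v hpos) hpos.le
      rw [mul_sub, mul_div_cancel₀ _ hpos.ne'] at this
      linarith
  -- Doubling the allocation is affordable only against a nonnegative weight, which is why `ψ` must
  -- dominate the virtual value and also be nonnegative.
  have s3 : ∫ v, ψ v * majorant C V x U v ∂μ ≤ ∫ v, 2 * (ψ v * x v) ∂μ := by
    refine integral_mono_ae i5 (i3.const_mul 2) ?_
    filter_upwards [haeV] with v hv
    have := mul_le_mul_of_nonneg_left (h.majorant_le hV0 hV hx hU hC hv) (hψ0 v)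
    linarith
  rw [integral_add r1 i4] at s1
  rw [integral_const_mul] at s3
  linarith

end InterimIC

/-! ### The payment identity for monotone allocation rules -/

section PaymentIdentity

variable {x : ℝ → ℝ} {C : ℝ}

theorem mul_sub_le_integral (hx : Monotone x) {a b : ℝ} (hab : a ≤ b) :
    (b - a) * x a ≤ ∫ z in a..b, x z := by
  have := intervalIntegral.integral_mono_on hab (intervalIntegrable_const (c := x a))
    (hx.intervalIntegrable (μ := volume)) fun z hz => hx hz.1
  simpa using this

theorem integral_le_mul_sub (hx : Monotone x) {a b : ℝ} (hab : a ≤ b) :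
    ∫ z in a..b, x z ≤ (b - a) * x b := by
  have := intervalIntegral.integral_mono_on hab
    (hx.intervalIntegrable (μ := volume))
    (intervalIntegrable_const (c := x b)) fun z hz => hx hz.2
  simpa using this

theorem rnPayment_nonneg (hx : Monotone x) (v : ℝ) : 0 ≤ rnPayment x v := by
  rw [rnPayment]
  rcases le_total 0 v with h | h
  · have := integral_le_mul_sub hx h
    linarith
  · have := mul_sub_le_integral hx h
    rw [intervalIntegral.integral_symm]
    linarith

/-- The supremum in the closed form of the capacitated payment rule. -/
def capExcess (C : ℝ) (x : ℝ → ℝ) (v : ℝ) : ℝ :=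
  sSup ((fun u => max (vcPayment C x u - rnPayment x u) 0) '' Set.Icc 0 v)

theorem capPayment_eq (C : ℝ) (x : ℝ → ℝ) (v : ℝ) :
    capPayment C x v = rnPayment x v + capExcess C x v := rfl

theorem vcPayment_sub_rnPayment (C : ℝ) (x : ℝ → ℝ) (u : ℝ) :
    vcPayment C x u - rnPayment x u = (∫ z in (0 : ℝ)..u, x z) - C * x u := by
  rw [vcPayment, rnPayment]; ring

theorem capExcess_nonneg (C : ℝ) (x : ℝ → ℝ) (v : ℝ) : 0 ≤ capExcess C x v := by
  refine Real.sSup_nonneg ?_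
  rintro _ ⟨u, _, rfl⟩
  exact le_max_right _ _

theorem capExcess_le {v b : ℝ} (hb : 0 ≤ b)
    (h : ∀ u, 0 ≤ u → u ≤ v → (∫ z in (0 : ℝ)..u, x z) - C * x u ≤ b) : capExcess C x v ≤ b := by
  refine Real.sSup_le ?_ hb
  rintro _ ⟨u, hu, rfl⟩
  refine max_le ?_ hb
  rw [vcPayment_sub_rnPayment]
  exact h u hu.1 hu.2

theorem le_capExcess (hC : 0 ≤ C) (hx0 : ∀ v, 0 ≤ x v) (hx1 : ∀ v, x v ≤ 1) {u v : ℝ}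
    (hu : 0 ≤ u) (huv : u ≤ v) : (∫ z in (0 : ℝ)..u, x z) - C * x u ≤ capExcess C x v := by
  rw [← vcPayment_sub_rnPayment]
  exact (le_max_left _ _).trans
    (le_csSup (bddAbove_capPayment hC hx0 hx1 v) (Set.mem_image_of_mem _ ⟨hu, huv⟩))

theorem monotone_capExcess (hC : 0 ≤ C) (hx0 : ∀ v, 0 ≤ x v) (hx1 : ∀ v, x v ≤ 1) :
    Monotone (capExcess C x) := fun _ _ hab =>
  capExcess_le (capExcess_nonneg C x _) fun _ hu hua => le_capExcess hC hx0 hx1 hu (hua.trans hab)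

theorem rnPayment_le_capPayment (C : ℝ) (x : ℝ → ℝ) (v : ℝ) :
    rnPayment x v ≤ capPayment C x v := by
  rw [capPayment_eq]; linarith [capExcess_nonneg C x v]

theorem vcPayment_le_capPayment (hC : 0 ≤ C) (hx0 : ∀ v, 0 ≤ x v) (hx1 : ∀ v, x v ≤ 1) {v : ℝ}
    (hv : 0 ≤ v) : vcPayment C x v ≤ capPayment C x v := by
  have := le_capExcess hC hx0 hx1 hv le_rfl
  rw [← vcPayment_sub_rnPayment] at this
  rw [capPayment_eq]; linarith

/-- The excess over the risk-neutral payment never exceeds the risk-neutral utility `∫ x`. This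
yields the requirement that a winner pays at most her report. -/
theorem capPayment_le_mul (hx : Monotone x) (hC : 0 ≤ C) (hx0 : ∀ v, 0 ≤ x v) {v : ℝ}
    (hv : 0 ≤ v) : capPayment C x v ≤ v * x v := by
  have h0 : ∀ a b, a ≤ b → 0 ≤ ∫ z in a..b, x z := fun a b hab =>
    intervalIntegral.integral_nonneg hab fun z _ => hx0 z
  have : capExcess C x v ≤ ∫ z in (0 : ℝ)..v, x z := by
    refine capExcess_le (h0 0 v hv) fun u hu huv => ?_
    have h1 := intervalIntegral.integral_add_adjacent_intervals
      (hx.intervalIntegrable (μ := volume) (a := 0) (b := u))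
      (hx.intervalIntegrable (μ := volume) (a := u) (b := v))
    have h2 := h0 u v huv
    have h3 := mul_nonneg hC (hx0 u)
    linarith
  rw [capPayment_eq, rnPayment]; linarith

theorem capPayment_nonneg (hx : Monotone x) (v : ℝ) : 0 ≤ capPayment C x v :=
  (rnPayment_nonneg hx v).trans (rnPayment_le_capPayment C x v)

theorem measurable_capPayment (hx : Monotone x) (hC : 0 ≤ C) (hx0 : ∀ v, 0 ≤ x v)
    (hx1 : ∀ v, x v ≤ 1) : Measurable (capPayment C x) := by
  have : capPayment C x = fun v => (v * x v - ∫ z in (0 : ℝ)..v, x z) + capExcess C x v := rfl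
  rw [this]
  exact ((measurable_id.mul hx.measurable).sub
    (continuous_primitive_of_bounded hx.measurable hx0 hx1).measurable).add
    (monotone_capExcess hC hx0 hx1).measurable

theorem capPayment_eq_zero (hx : Monotone x) (hC : 0 ≤ C) (hx0 : ∀ v, 0 ≤ x v) {v : ℝ}
    (hv : 0 ≤ v) (h : x v = 0) : capPayment C x v = 0 := by
  refine le_antisymm ?_ (capPayment_nonneg hx v)
  simpa [h] using capPayment_le_mul hx hC hx0 hv

/-- The default value of division by zero does no damage, because the payment vanishes wherever the
allocation does. -/
theorem mul_capPayment_div (hx : Monotone x) (hC : 0 ≤ C) (hx0 : ∀ v, 0 ≤ x v) {v : ℝ}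
    (hv : 0 ≤ v) : x v * (capPayment C x v / x v) = capPayment C x v := by
  by_cases h : x v = 0
  · rw [capPayment_eq_zero hx hC hx0 hv h, zero_div, mul_zero]
  · exact mul_div_cancel₀ _ h

/-- The price is at least value minus capacity, so a truthful winner's wealth never exceeds her
capacity and her utility is linear in the payment. -/
theorem truthful_utility (hx : Monotone x) (hC : 0 ≤ C) (hx0 : ∀ v, 0 ≤ x v)
    (hx1 : ∀ v, x v ≤ 1) {v : ℝ} (hv : 0 ≤ v) :
    x v * min (v - capPayment C x v / x v) C = (∫ z in (0 : ℝ)..v, x z) - capExcess C x v := by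
  have h := vcPayment_le_capPayment hC hx0 hx1 hv
  have e := mul_capPayment_div hx hC hx0 hv
  rcases (hx0 v).eq_or_lt with h0 | hpos
  · have e0 := capPayment_eq_zero hx hC hx0 hv h0.symm
    rw [capPayment_eq, rnPayment, ← h0] at e0
    rw [← h0]; linarith
  · rw [min_eq_left, mul_sub, e, capPayment_eq, rnPayment]
    · ring
    · rw [sub_le_comm, le_div_iff₀ hpos]; exact h

/-- Truthful reporting is optimal under the payment identity. -/
theorem utility_le_truthful (hx : Monotone x) (hC : 0 ≤ C) (hx0 : ∀ v, 0 ≤ x v)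
    (hx1 : ∀ v, x v ≤ 1) {v z : ℝ} (hv : 0 ≤ v) (hz : 0 ≤ z) :
    x z * min (v - capPayment C x z / x z) C ≤ x v * min (v - capPayment C x v / x v) C := by
  rw [truthful_utility hx hC hx0 hx1 hv]
  have e := mul_capPayment_div hx hC hx0 hz
  have hadd := fun a b c : ℝ => intervalIntegral.integral_add_adjacent_intervals
    (hx.intervalIntegrable (μ := volume) (a := a) (b := b))
    (hx.intervalIntegrable (μ := volume) (a := b) (b := c))
  have b1 : x z * min (v - capPayment C x z / x z) C
      ≤ (v - z) * x z + (∫ t in (0 : ℝ)..z, x t) - capExcess C x z := by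
    refine (mul_le_mul_of_nonneg_left (min_le_left _ _) (hx0 z)).trans (le_of_eq ?_)
    rw [mul_sub, e, capPayment_eq, rnPayment]
    ring
  have b2 : x z * min (v - capPayment C x z / x z) C ≤ C * x z := by
    rw [mul_comm C]
    exact mul_le_mul_of_nonneg_left (min_le_right _ _) (hx0 z)
  have b3 : x z * min (v - capPayment C x z / x z) C
      ≤ (∫ t in (0 : ℝ)..v, x t) - capExcess C x z := by
    refine b1.trans ?_
    rcases le_total z v with h | h
    · have := mul_sub_le_integral hx h
      have := hadd 0 z v
      linarith
    · have := integral_le_mul_sub hx h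
      have := hadd 0 v z
      linarith
  -- The claim becomes an upper bound for the supremum `capExcess C x v`, checked at each `u ≤ v`.
  -- For `u ≤ z` the term already enters `capExcess C x z`, so `b3` suffices. For `z ≤ u` the
  -- capacity bound `b2` together with `x z ≤ x u` suffices.
  rw [le_sub_comm]
  refine capExcess_le ?_ fun u hu huv => ?_
  · have := capExcess_nonneg C x z
    linarith
  · rcases le_total u z with h | h
    · have := le_capExcess hC hx0 hx1 hu h
      linarith
    · have h1 := mul_le_mul_of_nonneg_left (hx h) hC
      have h2 : 0 ≤ ∫ t in u..v, x t := intervalIntegral.integral_nonneg huv fun t _ => hx0 t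
      have := hadd 0 u v
      linarith

end PaymentIdentity

/-! ### Allocation by score -/

section Score

variable {n : ℕ} {s : Fin n → ℝ → EReal}

theorem scoreAlloc_zero_or_one (s : Fin n → ℝ → EReal) (v : Fin n → ℝ) (i : Fin n) :
    scoreAlloc s v i = 0 ∨ scoreAlloc s v i = 1 := by
  unfold scoreAlloc; split_ifs <;> simp

theorem scoreAlloc_nonneg (s : Fin n → ℝ → EReal) (v : Fin n → ℝ) (i : Fin n) :
    0 ≤ scoreAlloc s v i := by
  rcases scoreAlloc_zero_or_one s v i with h | h <;> rw [h]
  exact zero_le_one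

theorem scoreAlloc_le_one (s : Fin n → ℝ → EReal) (v : Fin n → ℝ) (i : Fin n) :
    scoreAlloc s v i ≤ 1 := by
  rcases scoreAlloc_zero_or_one s v i with h | h <;> rw [h]
  exact zero_le_one

theorem scoreAlloc_eq_zero_of_nonpos {v : Fin n → ℝ} {i : Fin n} (h : s i (v i) ≤ 0) :
    scoreAlloc s v i = 0 := by
  unfold scoreAlloc
  rw [if_neg fun h' => absurd h'.1 (not_lt.2 h)]

theorem scoreAlloc_eq_zero_of_ne {v : Fin n → ℝ} {i j : Fin n} (h : scoreAlloc s v i = 1)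
    (hij : j ≠ i) : scoreAlloc s v j = 0 := by
  have hi : 0 < s i (v i) ∧ (∀ k, s k (v k) ≤ s i (v i)) ∧ ∀ k, k < i → s k (v k) < s i (v i) := by
    by_contra hc
    rw [scoreAlloc, if_neg hc] at h
    exact zero_ne_one h
  unfold scoreAlloc
  refine if_neg fun hj => ?_
  rcases lt_or_gt_of_ne hij with hlt | hlt
  · exact absurd (hj.2.1 i) (not_le.2 (hi.2.2 j hlt))
  · exact absurd (hi.2.1 j) (not_le.2 (hj.2.2 i hlt))

theorem sum_scoreAlloc_le_one (s : Fin n → ℝ → EReal) (v : Fin n → ℝ) :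
    ∑ i, scoreAlloc s v i ≤ 1 := by
  by_cases h : ∃ i, scoreAlloc s v i = 1
  · obtain ⟨i, hi⟩ := h
    rw [Finset.sum_eq_single i (fun j _ hj => scoreAlloc_eq_zero_of_ne hi hj) (by simp), hi]
  · push Not at h
    rw [Finset.sum_eq_zero fun i _ => (scoreAlloc_zero_or_one s v i).resolve_right (h i)]
    exact zero_le_one

/-- The score-based allocation maximizes the positive score among feasible allocations. -/
theorem sum_mul_le_sum_scoreAlloc (hs : ∀ i v, s i v ≠ ⊤) (v c : Fin n → ℝ)
    (hc0 : ∀ i, 0 ≤ c i) (hc1 : ∑ i, c i ≤ 1) :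
    ∑ i, (max (s i (v i)) 0).toReal * c i
      ≤ ∑ i, (max (s i (v i)) 0).toReal * scoreAlloc s v i := by
  have hψ0 : ∀ i, 0 ≤ (max (s i (v i)) 0).toReal := fun i => EReal.toReal_nonneg (le_max_right _ _)
  by_cases hpos : ∃ i, 0 < s i (v i)
  swap
  · push Not at hpos
    simp [max_eq_right (hpos _)]
  obtain ⟨i₀, hi₀⟩ := hpos
  -- The least index among the maximizers is the winner under the tie-breaking rule.
  let T : Finset (Fin n) := Finset.univ.filter fun i => ∀ j, s j (v j) ≤ s i (v i)
  have hT : T.Nonempty := by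
    obtain ⟨k, -, hk⟩ := Finset.exists_max_image Finset.univ (fun i => s i (v i))
      ⟨i₀, Finset.mem_univ _⟩
    exact ⟨k, by simpa [T] using hk⟩
  have hk := T.min'_mem hT
  set k := T.min' hT with hkdef
  have hmax : ∀ j, s j (v j) ≤ s k (v k) := by simpa [T] using hk
  have hfirst : ∀ j, j < k → s j (v j) < s k (v k) := by
    intro j hj
    refine lt_of_le_of_ne (hmax j) fun he => ?_
    have : j ∈ T := by simpa [T, he] using hmax
    exact absurd (T.min'_le j this) (not_le.2 hj)
  have hak : scoreAlloc s v k = 1 := if_pos ⟨hi₀.trans_le (hmax i₀), hmax, hfirst⟩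
  have htop : max (s k (v k)) 0 ≠ ⊤ := by
    rcases max_choice (s k (v k)) 0 with h | h <;> rw [h]
    · exact hs k _
    · exact EReal.zero_ne_top
  have hle : ∀ j, (max (s j (v j)) 0).toReal ≤ (max (s k (v k)) 0).toReal := fun j =>
    EReal.toReal_le_toReal (max_le_max (hmax j) le_rfl)
      (ne_bot_of_le_ne_bot EReal.zero_ne_bot (le_max_right _ _)) htop
  have hsum : ∑ i, (max (s i (v i)) 0).toReal * scoreAlloc s v i
      = (max (s k (v k)) 0).toReal := by
    rw [Finset.sum_eq_single k (fun j _ hj => by rw [scoreAlloc_eq_zero_of_ne hak hj, mul_zero])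
      (by simp), hak, mul_one]
  rw [hsum]
  calc _ ≤ ∑ i, (max (s k (v k)) 0).toReal * c i :=
        Finset.sum_le_sum fun i _ => mul_le_mul_of_nonneg_right (hle i) (hc0 i)
    _ = (max (s k (v k)) 0).toReal * ∑ i, c i := by rw [Finset.mul_sum]
    _ ≤ _ := mul_le_of_le_one_right (hψ0 k) hc1

theorem measurable_scoreAlloc (hs : ∀ i, Measurable (s i)) (i : Fin n) :
    Measurable fun v => scoreAlloc s v i := by
  have hm : ∀ j, Measurable fun v : Fin n → ℝ => s j (v j) := fun j =>
    (hs j).comp (measurable_pi_apply j)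
  unfold scoreAlloc
  refine Measurable.ite ?_ measurable_const measurable_const
  refine (measurableSet_lt measurable_const (hm i)).inter
    (MeasurableSet.inter ?_ ?_)
  · have : {v : Fin n → ℝ | ∀ j, s j (v j) ≤ s i (v i)}
        = ⋂ j, {v : Fin n → ℝ | s j (v j) ≤ s i (v i)} := by ext; simp
    exact MeasurableSet.congr (MeasurableSet.iInter fun j => measurableSet_le (hm j) (hm i)) this.symm
  · have : {v : Fin n → ℝ | ∀ j, j < i → s j (v j) < s i (v i)}
        = ⋂ j, ⋂ (_ : j < i), {v : Fin n → ℝ | s j (v j) < s i (v i)} := by ext; simp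
    exact MeasurableSet.congr (MeasurableSet.iInter fun j => MeasurableSet.iInter fun _ =>
      measurableSet_lt (hm j) (hm i)) this.symm

theorem monotone_scoreAlloc_update {i : Fin n} (hs : Monotone (s i)) (v : Fin n → ℝ) :
    Monotone fun z => scoreAlloc s (Function.update v i z) i := by
  intro y z hyz
  rcases scoreAlloc_zero_or_one s (Function.update v i y) i with h | h
  · simp only [h]; exact scoreAlloc_nonneg _ _ _
  · have hi : 0 < s i y ∧ (∀ k, s k (Function.update v i y k) ≤ s i y) ∧
        ∀ k, k < i → s k (Function.update v i y k) < s i y := by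
      by_contra hc
      rw [scoreAlloc, Function.update_self, if_neg hc] at h
      exact zero_ne_one h
    have hyz' := hs hyz
    have : scoreAlloc s (Function.update v i z) i = 1 := by
      rw [scoreAlloc, Function.update_self]
      refine if_pos ⟨hi.1.trans_le hyz', fun k => ?_, fun k hk => ?_⟩
      · by_cases hki : k = i
        · subst hki; simp
        · have := hi.2.1 k
          rw [Function.update_of_ne hki] at this ⊢
          exact this.trans hyz'
      · have := hi.2.2 k hk
        rw [Function.update_of_ne hk.ne] at this ⊢
        exact this.trans_le hyz'
    dsimp only
    rw [h, this]

end Score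

section Interim

variable {n : ℕ} {s : Fin n → ℝ → EReal} (μ : Fin n → Measure ℝ)
  [∀ i, IsProbabilityMeasure (μ i)]

theorem measurable_update_const (i : Fin n) (z : ℝ) :
    Measurable fun v : Fin n → ℝ => Function.update v i z :=
  (measurable_update_prod i).comp (measurable_const.prodMk measurable_id)

theorem integrable_scoreAlloc_update (hs : ∀ i, Measurable (s i)) (i : Fin n) (z : ℝ) :
    Integrable (fun v => scoreAlloc s (Function.update v i z) i) (Measure.pi μ) := by
  refine Integrable.of_bound ((measurable_scoreAlloc hs i).comp
    (measurable_update_const i z)).aestronglyMeasurable 1 (ae_of_all _ fun v => ?_)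
  rw [Real.norm_eq_abs, abs_of_nonneg (scoreAlloc_nonneg _ _ _)]
  exact scoreAlloc_le_one _ _ _

theorem interimAlloc_scoreAlloc_nonneg (μ : Fin n → Measure ℝ) (i : Fin n) (z : ℝ) :
    0 ≤ interimAlloc μ (scoreAlloc s) i z :=
  integral_nonneg fun _ => scoreAlloc_nonneg _ _ _

theorem interimAlloc_scoreAlloc_le_one (hs : ∀ i, Measurable (s i)) (i : Fin n) (z : ℝ) :
    interimAlloc μ (scoreAlloc s) i z ≤ 1 := by
  have := integral_mono (integrable_scoreAlloc_update μ hs i z)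
    (integrable_const (1 : ℝ)) fun v => scoreAlloc_le_one _ _ _
  simpa [interimAlloc] using this

theorem monotone_interimAlloc_scoreAlloc (hs : ∀ i, Monotone (s i)) (i : Fin n) :
    Monotone (interimAlloc μ (scoreAlloc s) i) := fun y z hyz =>
  integral_mono (integrable_scoreAlloc_update μ (fun j => (hs j).measurable) i y)
    (integrable_scoreAlloc_update μ (fun j => (hs j).measurable) i z)
    fun v => monotone_scoreAlloc_update (hs i) v hyz

theorem interimAlloc_scoreAlloc_eq_zero (μ : Fin n → Measure ℝ) {i : Fin n} {z : ℝ} (h : s i z ≤ 0) :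
    interimAlloc μ (scoreAlloc s) i z = 0 := by
  have h0 : ∀ v : Fin n → ℝ, scoreAlloc s (Function.update v i z) i = 0 := fun v =>
    scoreAlloc_eq_zero_of_nonpos (by simpa using h)
  simp [interimAlloc, h0]

theorem interimAlloc_eq_integral_prod {Ω : Type*} [MeasurableSpace Ω] (ν : Measure Ω)
    [IsProbabilityMeasure ν] (a : (Fin n → ℝ) → Fin n → ℝ) (i : Fin n) (z : ℝ) :
    interimAlloc μ a i z
      = ∫ p : Ω × (Fin n → ℝ), a (Function.update p.2 i z) i ∂(ν.prod (Measure.pi μ)) := by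
  rw [integral_fun_snd (μ := ν) fun v => a (Function.update v i z) i]
  simp [interimAlloc]

end Interim

/-! ### Payment-identity mechanisms with score-based allocation -/

section PaymentIdentityMechanism

variable {n : ℕ} {s : Fin n → ℝ → EReal} {μ : Fin n → Measure ℝ}
  [∀ i, IsProbabilityMeasure (μ i)] {C : Fin n → ℝ} {V : Fin n → Set ℝ}

theorem measurable_price (hs : ∀ i, Monotone (s i)) (hC : ∀ i, 0 < C i) (i : Fin n) :
    Measurable fun z => capPayment (C i) (interimAlloc μ (scoreAlloc s) i) z
      / interimAlloc μ (scoreAlloc s) i z :=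
  (measurable_capPayment (monotone_interimAlloc_scoreAlloc μ hs i) (hC i).le
    (interimAlloc_scoreAlloc_nonneg μ i)
    (interimAlloc_scoreAlloc_le_one μ (fun j => (hs j).measurable) i)).div
    (monotone_interimAlloc_scoreAlloc μ hs i).measurable

theorem price_nonneg (hs : ∀ i, Monotone (s i)) (i : Fin n) (z : ℝ) :
    0 ≤ capPayment (C i) (interimAlloc μ (scoreAlloc s) i) z
      / interimAlloc μ (scoreAlloc s) i z :=
  div_nonneg (capPayment_nonneg (monotone_interimAlloc_scoreAlloc μ hs i) z)
    (interimAlloc_scoreAlloc_nonneg μ i z)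

theorem isAuction_paymentIdentityMechanism (hs : ∀ i, Monotone (s i)) (hC : ∀ i, 0 < C i)
    (hV : ∀ i, V i ⊆ Set.Ici 0) :
    (paymentIdentityMechanism μ C (scoreAlloc s)).IsAuction V where
  isProbabilityMeasure_seed := by
    change IsProbabilityMeasure (Measure.dirac ())
    infer_instance
  measurable_alloc i := (measurable_scoreAlloc (fun j => (hs j).measurable) i).comp measurable_snd
  measurable_pay i := ((measurable_scoreAlloc (fun j => (hs j).measurable) i).mul
    ((measurable_price hs hC i).comp (measurable_pi_apply i))).comp measurable_snd
  alloc_zero_or_one _ v _ i := scoreAlloc_zero_or_one s v i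
  sum_alloc_le_one _ v _ := sum_scoreAlloc_le_one s v
  pay_loser _ v _ i h := by
    change scoreAlloc s v i * _ = 0
    rw [show scoreAlloc s v i = 0 from h, zero_mul]
  pay_winner_le _ v hv i h := by
    change scoreAlloc s v i * _ ≤ v i
    rw [show scoreAlloc s v i = 1 from h, one_mul]
    have hv0 : 0 ≤ v i := hV i (hv i)
    exact div_le_of_le_mul₀ (interimAlloc_scoreAlloc_nonneg μ i _) hv0
      (capPayment_le_mul (monotone_interimAlloc_scoreAlloc μ hs i) (hC i).le
        (interimAlloc_scoreAlloc_nonneg μ i) hv0)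

theorem isOnePriced_paymentIdentityMechanism (μ : Fin n → Measure ℝ) (C : Fin n → ℝ)
    (a : (Fin n → ℝ) → Fin n → ℝ) (V : Fin n → Set ℝ) :
    (paymentIdentityMechanism μ C a).IsOnePriced V := by
  refine ⟨fun i z => capPayment (C i) (interimAlloc μ a i) z / interimAlloc μ a i z,
    fun _ v _ i => ⟨fun h => ?_, fun h => ?_⟩⟩
  · change a v i * _ = _
    rw [show a v i = 1 from h, one_mul]
  · change a v i * _ = _
    rw [show a v i = 0 from h, zero_mul]

/-- The price depends on the report alone and a loser has utility `min 0 C = 0`, so the winning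
probability factors out even though capped utility is nonlinear. -/
theorem interimUtility_paymentIdentityMechanism {i : Fin n} (hC : 0 < C i) (v z : ℝ) :
    (paymentIdentityMechanism μ C (scoreAlloc s)).interimUtility μ (C i) i v z
      = interimAlloc μ (scoreAlloc s) i z
        * min (v - capPayment (C i) (interimAlloc μ (scoreAlloc s) i) z
          / interimAlloc μ (scoreAlloc s) i z) (C i) := by
  rw [Mechanism.interimUtility]
  conv_rhs => rw [interimAlloc_eq_integral_prod μ (Measure.dirac ()), ← integral_mul_const]
  refine integral_congr_ae (ae_of_all _ fun p => ?_)
  simp only [paymentIdentityMechanism, Function.update_self, capUtility]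
  rw [← interimAlloc_eq_integral_prod μ (Measure.dirac ())]
  rcases scoreAlloc_zero_or_one s (Function.update p.2 i z) i with h | h <;> rw [h]
  · simp [hC.le]
  · simp

theorem isBIC_paymentIdentityMechanism (hs : ∀ i, Monotone (s i)) (hC : ∀ i, 0 < C i)
    (hV : ∀ i, V i ⊆ Set.Ici 0) :
    (paymentIdentityMechanism μ C (scoreAlloc s)).IsBIC V μ C := by
  intro i v hv z hz
  rw [interimUtility_paymentIdentityMechanism (hC i), interimUtility_paymentIdentityMechanism (hC i)]
  exact utility_le_truthful (monotone_interimAlloc_scoreAlloc μ hs i) (hC i).le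
    (interimAlloc_scoreAlloc_nonneg μ i)
    (interimAlloc_scoreAlloc_le_one μ (fun j => (hs j).measurable) i) (hV i hv) (hV i hz)

/-- Interim lower bounds for the payment rules add up to a lower bound for the revenue. -/
theorem sum_lintegral_le_revenue (hs : ∀ i, Monotone (s i)) (hC : ∀ i, 0 < C i)
    (hμ : ∀ i, ∀ᵐ z ∂(μ i), 0 ≤ z) {q : Fin n → ℝ → ℝ}
    (hq : ∀ i z, 0 ≤ z → q i z ≤ capPayment (C i) (interimAlloc μ (scoreAlloc s) i) z) :
    ((∑ i, ∫⁻ z, ENNReal.ofReal (q i z) ∂(μ i) : ENNReal) : EReal)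
      ≤ (paymentIdentityMechanism μ C (scoreAlloc s)).revenue μ := by
  have hsm : ∀ i, Measurable (s i) := fun i => (hs i).measurable
  have ham := measurable_scoreAlloc hsm
  set b : Fin n → ℝ → ℝ := fun i z => capPayment (C i) (interimAlloc μ (scoreAlloc s) i) z
      / interimAlloc μ (scoreAlloc s) i z with hb
  have hpay0 : ∀ (v : Fin n → ℝ) i, 0 ≤ scoreAlloc s v i * b i (v i) := fun v i =>
    mul_nonneg (scoreAlloc_nonneg s v i) (price_nonneg hs i _)
  have hpm : ∀ i, Measurable fun p : Unit × (Fin n → ℝ) =>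
      ENNReal.ofReal (scoreAlloc s p.2 i * b i (p.2 i)) := fun i =>
    (((ham i).mul ((measurable_price hs hC i).comp (measurable_pi_apply i))).comp
      measurable_snd).ennreal_ofReal
  have hrev : (paymentIdentityMechanism μ C (scoreAlloc s)).revenue μ
      = ((∑ i, ∫⁻ p : Unit × (Fin n → ℝ), ENNReal.ofReal (scoreAlloc s p.2 i * b i (p.2 i))
        ∂((Measure.dirac ()).prod (Measure.pi μ)) : ENNReal) : EReal) := by
    -- Payments here are nonnegative, so the negative part of the revenue drops out and no
    -- integrability is required.
    have hneg : ∀ p : Unit × (Fin n → ℝ),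
        ENNReal.ofReal (-∑ i, scoreAlloc s p.2 i * b i (p.2 i)) = 0 := fun p =>
      ENNReal.ofReal_of_nonpos (neg_nonpos.2 (Finset.sum_nonneg fun i _ => hpay0 p.2 i))
    have hpos : ∀ p : Unit × (Fin n → ℝ),
        ENNReal.ofReal (∑ i, scoreAlloc s p.2 i * b i (p.2 i))
          = ∑ i, ENNReal.ofReal (scoreAlloc s p.2 i * b i (p.2 i)) := fun p =>
      ENNReal.ofReal_sum_of_nonneg fun i _ => hpay0 p.2 i
    simp only [Mechanism.revenue, paymentIdentityMechanism]
    rw [lintegral_congr hneg, lintegral_congr hpos, lintegral_finsetSum _ fun i _ => hpm i]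
    simp
  rw [hrev, EReal.coe_ennreal_le_coe_ennreal_iff]
  refine Finset.sum_le_sum fun i _ => ?_
  rw [lintegral_resample (Measure.dirac ()) μ i (hpm i)]
  refine lintegral_mono_ae ?_
  filter_upwards [hμ i] with z hz
  simp only [Function.update_self]
  have h1 : ∫⁻ p : Unit × (Fin n → ℝ),
      ENNReal.ofReal (scoreAlloc s (Function.update p.2 i z) i * b i z)
        ∂((Measure.dirac ()).prod (Measure.pi μ))
      = ENNReal.ofReal (interimAlloc μ (scoreAlloc s) i z * b i z) := by
    rw [interimAlloc_eq_integral_prod μ (Measure.dirac ()), ← integral_mul_const,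
      ofReal_integral_eq_lintegral_ofReal]
    · exact ((integrable_scoreAlloc_update μ hsm i z).comp_snd _).mul_const _
    · exact ae_of_all _ fun p => mul_nonneg (scoreAlloc_nonneg _ _ _) (price_nonneg hs i _)
  rw [h1]
  refine ENNReal.ofReal_le_ofReal ((hq i z hz).trans_eq ?_)
  exact (mul_capPayment_div (monotone_interimAlloc_scoreAlloc μ hs i) (hC i).le
    (interimAlloc_scoreAlloc_nonneg μ i) hz).symm

end PaymentIdentityMechanism

/-! ### The interim view of an arbitrary incentive compatible auction -/

/-- Concavity: for wealth `w ≤ C`, an increment `t ≤ C` taken in proportion `1 - w / C` exceeds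
neither `t` nor the remaining room `C - w`. Past the capacity both sides equal `C`. The bound is
affine in the capped utility, so it survives taking expectations. -/
theorem capUtility_add_le {C w t : ℝ} (hC : 0 < C) (hw : 0 ≤ w) (ht : 0 ≤ t) :
    capUtility C w + min t C * (1 - capUtility C w / C) ≤ capUtility C (w + t) := by
  unfold capUtility
  rcases le_total C w with h | h
  · rw [min_eq_right h, min_eq_right (show C ≤ w + t by linarith), div_self hC.ne']; simp
  · rw [min_eq_left h]
    have h1 : w / C ≤ 1 := (div_le_one hC).2 h
    have h2 : 0 ≤ w / C := div_nonneg hw hC.le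
    have e : w / C * C = w := div_mul_cancel₀ _ hC.ne'
    refine le_min ?_ ?_
    · have := min_le_left t C
      have := mul_le_of_le_one_right (le_min ht hC.le) (show 1 - w / C ≤ 1 by linarith)
      linarith
    · have := mul_le_mul_of_nonneg_right (min_le_right t C) (show 0 ≤ 1 - w / C by linarith)
      nlinarith

theorem capUtility_sub_ge {C w t : ℝ} (ht : 0 ≤ t) :
    capUtility C w - t ≤ capUtility C (w - t) := by
  unfold capUtility
  refine le_min ?_ ?_
  · linarith [min_le_left w C]
  · linarith [min_le_right w C]

namespace Mechanism

variable {n : ℕ} {Ω : Type*} [MeasurableSpace Ω] (N : Mechanism n Ω) {V : Fin n → Set ℝ}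
  (μ : Fin n → Measure ℝ) [∀ i, IsProbabilityMeasure (μ i)] {C : Fin n → ℝ}

/-- The interim allocation rule of agent `i`, in expectation over the seed and the values of the
others. -/
def interimAllocation (i : Fin n) (z : ℝ) : ℝ :=
  ∫ p : Ω × (Fin n → ℝ), N.alloc p.1 (Function.update p.2 i z) i ∂(N.seed.prod (Measure.pi μ))

variable {N μ}

theorem measurable_resample {g : Ω → (Fin n → ℝ) → ℝ}
    (hg : Measurable fun p : Ω × (Fin n → ℝ) => g p.1 p.2) (i : Fin n) :
    Measurable fun p : ℝ × (Ω × (Fin n → ℝ)) => g p.2.1 (Function.update p.2.2 i p.1) :=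
  hg.comp ((measurable_fst.comp measurable_snd).prodMk
    ((measurable_update_prod i).comp (measurable_fst.prodMk
      (measurable_snd.comp measurable_snd))))

theorem measurable_resample_const {g : Ω → (Fin n → ℝ) → ℝ}
    (hg : Measurable fun p : Ω × (Fin n → ℝ) => g p.1 p.2) (i : Fin n) (z : ℝ) :
    Measurable fun p : Ω × (Fin n → ℝ) => g p.1 (Function.update p.2 i z) :=
  (measurable_resample hg i).comp (measurable_const.prodMk measurable_id)

theorem ae_mem_valueSpace (ν : Measure Ω) [IsProbabilityMeasure ν] (hμV : ∀ i, μ i (V i)ᶜ = 0) :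
    ∀ᵐ p : Ω × (Fin n → ℝ) ∂(ν.prod (Measure.pi μ)), ∀ j, p.2 j ∈ V j := by
  have h : ∀ᵐ v ∂(Measure.pi μ), ∀ j, v j ∈ V j := by
    rw [ae_all_iff]
    intro j
    exact (measurePreserving_eval μ j).quasiMeasurePreserving.ae (hμV j)
  exact Measure.quasiMeasurePreserving_snd.ae h

theorem update_mem {v : Fin n → ℝ} (hv : ∀ j, v j ∈ V j) {i : Fin n} {z : ℝ} (hz : z ∈ V i) :
    ∀ j, Function.update v i z j ∈ V j := by
  intro j
  by_cases h : j = i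
  · subst h; simpa using hz
  · simpa [Function.update_of_ne h] using hv j

theorem IsAuction.payoff_eq_zero_or (hN : N.IsAuction V) {ω : Ω} {v : Fin n → ℝ}
    (hv : ∀ j, v j ∈ V j) (i : Fin n) :
    (N.alloc ω v i = 0 ∧ N.pay ω v i = 0) ∨ (N.alloc ω v i = 1 ∧ N.pay ω v i ≤ v i) := by
  rcases hN.alloc_zero_or_one ω v hv i with h | h
  · exact Or.inl ⟨h, hN.pay_loser ω v hv i h⟩
  · exact Or.inr ⟨h, hN.pay_winner_le ω v hv i h⟩

theorem IsAuction.capUtility_mem_Icc (hN : N.IsAuction V) {ω : Ω} {v : Fin n → ℝ}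
    (hv : ∀ j, v j ∈ V j) (i : Fin n) {c : ℝ} (hc : 0 < c) :
    0 ≤ capUtility c (v i * N.alloc ω v i - N.pay ω v i) ∧
    capUtility c (v i * N.alloc ω v i - N.pay ω v i) ≤ c * N.alloc ω v i := by
  unfold capUtility
  rcases hN.payoff_eq_zero_or (ω := ω) hv i with ⟨h, h'⟩ | ⟨h, h'⟩
  · simp [h, h', hc.le]
  · rw [h]
    exact ⟨le_min (by linarith) hc.le, (min_le_right _ _).trans (by simp)⟩

/-- Payments may be unbounded below, but the capacity bounds utility above, and a winner paying at
most her report bounds it below. Interim utilities of misreports are therefore honest integrals. -/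
theorem IsAuction.abs_capUtility_le (hN : N.IsAuction V) {ω : Ω} {v : Fin n → ℝ}
    (hv : ∀ j, v j ∈ V j) (i : Fin n) {c : ℝ} (hc : 0 < c) (y : ℝ) :
    |capUtility c (y * N.alloc ω v i - N.pay ω v i)| ≤ |y - v i| + c := by
  unfold capUtility
  rcases hN.payoff_eq_zero_or (ω := ω) hv i with ⟨h, h'⟩ | ⟨h, h'⟩
  · simp only [h, h', mul_zero, sub_zero, min_eq_left hc.le, abs_zero]; positivity
  · rw [h, mul_one, abs_le]
    constructor
    · have := neg_abs_le (y - v i)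
      refine le_min (by linarith) ?_
      have := abs_nonneg (y - v i)
      linarith
    · have := abs_nonneg (y - v i)
      linarith [min_le_right (y - N.pay ω v i) c]

theorem IsAuction.measurable_capUtility (hN : N.IsAuction V) (i : Fin n) (c y z : ℝ) :
    Measurable fun p : Ω × (Fin n → ℝ) => capUtility c
      (y * N.alloc p.1 (Function.update p.2 i z) i - N.pay p.1 (Function.update p.2 i z) i) := by
  unfold capUtility
  exact (((measurable_resample_const (g := fun ω v => N.alloc ω v i) (hN.measurable_alloc i) i z).const_mul y).sub
    (measurable_resample_const (g := fun ω v => N.pay ω v i) (hN.measurable_pay i) i z)).min measurable_const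

theorem IsAuction.integrable_capUtility (hN : N.IsAuction V) (hμV : ∀ i, μ i (V i)ᶜ = 0)
    {i : Fin n} {c : ℝ} (hc : 0 < c) (y : ℝ) {z : ℝ} (hz : z ∈ V i) :
    Integrable (fun p : Ω × (Fin n → ℝ) => capUtility c
      (y * N.alloc p.1 (Function.update p.2 i z) i - N.pay p.1 (Function.update p.2 i z) i))
      (N.seed.prod (Measure.pi μ)) := by
  have := hN.isProbabilityMeasure_seed
  refine Integrable.of_bound (hN.measurable_capUtility i c y z).aestronglyMeasurable
    (|y - z| + c) ?_
  filter_upwards [ae_mem_valueSpace N.seed hμV] with p hp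
  simpa using hN.abs_capUtility_le (update_mem hp hz) i hc y

theorem IsAuction.integrable_alloc_update (hN : N.IsAuction V) (hμV : ∀ i, μ i (V i)ᶜ = 0)
    {i : Fin n} {z : ℝ} (hz : z ∈ V i) :
    Integrable (fun p : Ω × (Fin n → ℝ) => N.alloc p.1 (Function.update p.2 i z) i)
      (N.seed.prod (Measure.pi μ)) := by
  have := hN.isProbabilityMeasure_seed
  refine Integrable.of_bound
    (measurable_resample_const (g := fun ω v => N.alloc ω v i) (hN.measurable_alloc i) i z).aestronglyMeasurable 1 ?_
  filter_upwards [ae_mem_valueSpace N.seed hμV] with p hp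
  rcases hN.alloc_zero_or_one p.1 _ (update_mem hp hz) i with h | h <;> simp [h]

theorem IsAuction.interimIC (hN : N.IsAuction V) (hμV : ∀ i, μ i (V i)ᶜ = 0)
    (hC : ∀ i, 0 < C i) (hB : N.IsBIC V μ C) (i : Fin n) :
    InterimIC (C i) (V i) (N.interimAllocation μ i)
      (fun v => N.interimUtility μ (C i) i v v) := by
  have := hN.isProbabilityMeasure_seed
  have hae := ae_mem_valueSpace N.seed hμV
  have hiu := fun y {z} (hz : z ∈ V i) => hN.integrable_capUtility hμV (hC i) y hz
  have hia := fun {z} (hz : z ∈ V i) => hN.integrable_alloc_update hμV hz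
  have hmem := fun {p : Ω × (Fin n → ℝ)} (hp : ∀ j, p.2 j ∈ V j) {z} (hz : z ∈ V i) =>
    hN.capUtility_mem_Icc (ω := p.1) (update_mem hp hz) i (hC i)
  simp only [Function.update_self] at hmem
  refine ⟨fun v hv => ?_, fun v hv => ?_, fun v hv => ?_, fun v hv w hw hvw => ?_,
    fun v hv w hw hvw => ?_⟩
  · refine integral_nonneg_of_ae ?_
    filter_upwards [hae] with p hp
    exact (hmem hp hv).1
  · simp only [interimAllocation, interimUtility]
    rw [← integral_const_mul]
    refine integral_mono_ae (hiu v hv) ((hia hv).const_mul _) ?_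
    filter_upwards [hae] with p hp
    exact (hmem hp hv).2
  · have : ∫ _ : Ω × (Fin n → ℝ), (1 : ℝ) ∂(N.seed.prod (Measure.pi μ)) = 1 := by simp
    rw [← this]
    refine integral_mono_ae (hia hv) (integrable_const _) ?_
    filter_upwards [hae] with p hp
    rcases hN.alloc_zero_or_one p.1 _ (update_mem hp hv) i with h | h <;> simp [h]
  -- Upward constraint: value `w` reporting `v` gets the outcome of value `v`, improved by `w - v`
  -- when served; `capUtility_add_le` applies pointwise.
  · refine le_trans ?_ (hB i w hw v hv)
    simp only [interimAllocation, interimUtility]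
    have hi : Integrable (fun p : Ω × (Fin n → ℝ) => min (w - v) (C i) *
        (N.alloc p.1 (Function.update p.2 i v) i - capUtility (C i)
          (v * N.alloc p.1 (Function.update p.2 i v) i - N.pay p.1 (Function.update p.2 i v) i)
            / C i)) (N.seed.prod (Measure.pi μ)) :=
      ((hia hv).sub ((hiu v hv).div_const _)).const_mul _
    rw [← integral_div, ← integral_sub (hia hv) ((hiu v hv).div_const _), ← integral_const_mul,
      ← integral_add (hiu v hv) hi]
    refine integral_mono_ae ((hiu v hv).add hi) (hiu w hv) ?_
    filter_upwards [hae] with p hp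
    rcases hN.payoff_eq_zero_or (ω := p.1) (update_mem hp hv) i with ⟨h, h'⟩ | ⟨h, h'⟩
    · simp [h, h', capUtility, (hC i).le]
    · rw [Function.update_self] at h'
      rw [h, mul_one, mul_one]
      have := capUtility_add_le (hC i) (sub_nonneg.2 h') (sub_nonneg.2 hvw)
      rwa [show v - N.pay p.1 (Function.update p.2 i v) i + (w - v)
        = w - N.pay p.1 (Function.update p.2 i v) i by ring] at this
  -- Downward constraint: value `v` reporting `w` loses at most `w - v` relative to value `w`, and
  -- only when served.
  · rw [sub_le_iff_le_add', ← sub_le_iff_le_add]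
    refine le_trans ?_ (hB i v hv w hw)
    simp only [interimAllocation, interimUtility]
    rw [← integral_const_mul, ← integral_sub (hiu w hw) ((hia hw).const_mul _)]
    refine integral_mono_ae ((hiu w hw).sub ((hia hw).const_mul _)) (hiu v hw) ?_
    filter_upwards [hae] with p hp
    rcases hN.payoff_eq_zero_or (ω := p.1) (update_mem hp hw) i with ⟨h, h'⟩ | ⟨h, h'⟩
    · simp [h, h']
    · rw [h, mul_one, mul_one, mul_one]
      have := capUtility_sub_ge (C := C i) (w := w - N.pay p.1 (Function.update p.2 i w) i)
        (sub_nonneg.2 hvw)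
      rwa [show w - N.pay p.1 (Function.update p.2 i w) i - (w - v)
        = v - N.pay p.1 (Function.update p.2 i w) i by ring] at this

end Mechanism

/-! ### Scores -/

theorem toReal_max_coe_zero (r : ℝ) : (max (r : EReal) 0).toReal = max r 0 := by
  rcases le_total r 0 with h | h
  · rw [max_eq_right h, max_eq_right (EReal.coe_nonpos.2 h), EReal.toReal_zero]
  · rw [max_eq_left h, max_eq_left (EReal.coe_nonneg.2 h), EReal.toReal_coe]

theorem virtualValue_of_pos {μ : Measure ℝ} {f : ℝ → ℝ} {v : ℝ} (h : 0 < f v) :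
    virtualValue μ f v = ((v - (1 - ProbabilityTheory.cdf μ v) / f v : ℝ) : EReal) := if_pos h

theorem virtualValue_le {μ : Measure ℝ} {f : ℝ → ℝ} (v : ℝ) : virtualValue μ f v ≤ v := by
  unfold virtualValue
  split_ifs with h1 h2
  · rw [EReal.coe_le_coe_iff, sub_le_self_iff]
    exact div_nonneg (sub_nonneg.2 (ProbabilityTheory.cdf_le_one μ v)) h1.le
  · exact le_rfl
  · exact bot_le

theorem virtualValue_ne_top {μ : Measure ℝ} {f : ℝ → ℝ} (v : ℝ) : virtualValue μ f v ≠ ⊤ :=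
  ((virtualValue_le v).trans_lt (EReal.coe_lt_top v)).ne

/-- The positive part of the virtual value, as a real number. -/
def virtualValuePos (μ : Measure ℝ) (f : ℝ → ℝ) (v : ℝ) : ℝ := (max (virtualValue μ f v) 0).toReal

section VirtualValuePos

variable {μ : Measure ℝ} {f : ℝ → ℝ}

theorem virtualValuePos_nonneg (v : ℝ) : 0 ≤ virtualValuePos μ f v :=
  EReal.toReal_nonneg (le_max_right _ _)

theorem virtualValuePos_le {v : ℝ} (hv : 0 ≤ v) : virtualValuePos μ f v ≤ v := by
  have h : max (virtualValue μ f v) 0 ≤ (v : EReal) :=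
    max_le (virtualValue_le v) (EReal.coe_nonneg.2 hv)
  exact EReal.toReal_le_toReal h (ne_bot_of_le_ne_bot EReal.zero_ne_bot (le_max_right _ _))
    (EReal.coe_ne_top v)

theorem virtualValuePos_of_pos {v : ℝ} (h : 0 < f v) :
    virtualValuePos μ f v = max (v - (1 - ProbabilityTheory.cdf μ v) / f v) 0 := by
  rw [virtualValuePos, virtualValue_of_pos h, toReal_max_coe_zero]

theorem integrable_virtualValuePos (hreg : IsRegular μ f) (hμ : ∀ᵐ z ∂μ, 0 ≤ z)
    (hid : Integrable id μ) : Integrable (virtualValuePos μ f) μ := by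
  have hm : Measurable (virtualValuePos μ f) := by
    have : Monotone fun v => max (virtualValue μ f v) 0 := fun a b h => max_le_max (hreg h) le_rfl
    exact this.measurable.ereal_toReal
  refine hid.mono' hm.aestronglyMeasurable ?_
  filter_upwards [hμ] with v hv
  rw [Real.norm_eq_abs, abs_of_nonneg (virtualValuePos_nonneg v)]
  exact virtualValuePos_le hv

/-- The virtual surplus of an allocation rule that serves only positive virtual values. -/
theorem virtual_surplus_eq (hf : IsDensity μ f) {x : ℝ → ℝ}
    (hx : ∀ z, virtualValue μ f z ≤ 0 → x z = 0) (v : ℝ) :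
    (v * f v - (1 - ProbabilityTheory.cdf μ v)) * x v = f v * (virtualValuePos μ f v * x v) := by
  by_cases h0 : virtualValue μ f v ≤ 0
  · rw [hx v h0, mul_zero, mul_zero, mul_zero]
  have hpos := not_le.1 h0
  rcases (hf.nonneg v).eq_or_lt with h | h
  -- A positive virtual value at zero density is possible only in the convention for a distribution
  -- function equal to one, and there both sides vanish.
  · have hF : ProbabilityTheory.cdf μ v = 1 := by
      by_contra hF
      rw [virtualValue, if_neg (by rw [← h]; exact lt_irrefl _), if_neg hF] at hpos
      exact not_lt_bot hpos
    rw [← h, hF]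
    ring
  · rw [virtualValuePos_of_pos h]
    rw [virtualValue_of_pos h, EReal.coe_pos] at hpos
    rw [max_eq_left hpos.le, ← mul_assoc, mul_sub, mul_div_cancel₀ _ h.ne']
    ring

end VirtualValuePos

/-! ### Expected score of an allocation -/

section ExpectedScore

variable {n : ℕ} {Ω : Type*} [MeasurableSpace Ω] {μ : Fin n → Measure ℝ}
  [∀ i, IsProbabilityMeasure (μ i)]

theorem integrable_mul_alloc (ν : Measure Ω) [IsProbabilityMeasure ν] {a : Ω → (Fin n → ℝ) → ℝ}
    (ham : Measurable fun p : Ω × (Fin n → ℝ) => a p.1 p.2)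
    (ha : ∀ᵐ p ∂(ν.prod (Measure.pi μ)), ‖a p.1 p.2‖ ≤ 1) (i : Fin n) {φ : ℝ → ℝ}
    (hφ : Integrable φ (μ i)) :
    Integrable (fun p : Ω × (Fin n → ℝ) => φ (p.2 i) * a p.1 p.2) (ν.prod (Measure.pi μ)) := by
  have h1 : Integrable (fun v : Fin n → ℝ => φ (v i)) (Measure.pi μ) :=
    (measurePreserving_eval μ i).integrable_comp_of_integrable hφ
  exact (h1.comp_snd ν).mul_bdd ham.aestronglyMeasurable ha

theorem integral_mul_alloc (ν : Measure Ω) [IsProbabilityMeasure ν] {a : Ω → (Fin n → ℝ) → ℝ}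
    (ham : Measurable fun p : Ω × (Fin n → ℝ) => a p.1 p.2)
    (ha : ∀ᵐ p ∂(ν.prod (Measure.pi μ)), ‖a p.1 p.2‖ ≤ 1) (i : Fin n) {φ : ℝ → ℝ}
    (hφ : Integrable φ (μ i)) :
    ∫ p : Ω × (Fin n → ℝ), φ (p.2 i) * a p.1 p.2 ∂(ν.prod (Measure.pi μ))
      = ∫ z, φ z * ∫ p : Ω × (Fin n → ℝ), a p.1 (Function.update p.2 i z)
        ∂(ν.prod (Measure.pi μ)) ∂(μ i) := by
  rw [integral_resample ν μ i (integrable_mul_alloc ν ham ha i hφ)]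
  simp only [Function.update_self, integral_const_mul]

theorem norm_scoreAlloc_le (s : Fin n → ℝ → EReal) (v : Fin n → ℝ) (i : Fin n) :
    ‖scoreAlloc s v i‖ ≤ 1 := by
  rw [Real.norm_eq_abs, abs_of_nonneg (scoreAlloc_nonneg _ _ _)]
  exact scoreAlloc_le_one _ _ _

theorem integral_mul_scoreAlloc {s : Fin n → ℝ → EReal} (hs : ∀ i, Measurable (s i))
    (ν : Measure Ω) [IsProbabilityMeasure ν] (i : Fin n) {φ : ℝ → ℝ} (hφ : Integrable φ (μ i)) :
    ∫ p : Ω × (Fin n → ℝ), φ (p.2 i) * scoreAlloc s p.2 i ∂(ν.prod (Measure.pi μ))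
      = ∫ z, φ z * interimAlloc μ (scoreAlloc s) i z ∂(μ i) := by
  rw [integral_mul_alloc (a := fun _ v => scoreAlloc s v i) ν
    ((measurable_scoreAlloc hs i).comp measurable_snd)
    (ae_of_all _ fun p => norm_scoreAlloc_le s p.2 i) i hφ]
  simp only [interimAlloc_eq_integral_prod μ ν]

theorem lintegral_mul_scoreAlloc {s : Fin n → ℝ → EReal} (hs : ∀ i, Measurable (s i))
    (ν : Measure Ω) [IsProbabilityMeasure ν] (i : Fin n) {φ : ℝ → ℝ} (hφ : Measurable φ)
    (hφ0 : ∀ z, 0 ≤ φ z) :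
    ∫⁻ p : Ω × (Fin n → ℝ), ENNReal.ofReal (φ (p.2 i) * scoreAlloc s p.2 i)
        ∂(ν.prod (Measure.pi μ))
      = ∫⁻ z, ENNReal.ofReal (φ z * interimAlloc μ (scoreAlloc s) i z) ∂(μ i) := by
  have hm : Measurable fun p : Ω × (Fin n → ℝ) => ENNReal.ofReal (φ (p.2 i) * scoreAlloc s p.2 i) :=
    ((hφ.comp ((measurable_pi_apply i).comp measurable_snd)).mul
      ((measurable_scoreAlloc hs i).comp measurable_snd)).ennreal_ofReal
  rw [lintegral_resample ν μ i hm]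
  refine lintegral_congr fun z => ?_
  simp only [Function.update_self]
  rw [interimAlloc_eq_integral_prod μ ν, ← integral_const_mul, ofReal_integral_eq_lintegral_ofReal]
  · exact ((integrable_scoreAlloc_update μ hs i z).comp_snd ν).const_mul _
  · exact ae_of_all _ fun p => mul_nonneg (hφ0 z) (scoreAlloc_nonneg _ _ _)

/-- Any feasible allocation has at most the expected positive score of the score-based one. -/
theorem sum_integral_score_le {s : Fin n → ℝ → EReal} (hs : ∀ i, Measurable (s i))
    (hst : ∀ i v, s i v ≠ ⊤) (hsi : ∀ i, Integrable (fun z => (max (s i z) 0).toReal) (μ i))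
    {V : Fin n → Set ℝ} (hμV : ∀ i, μ i (V i)ᶜ = 0) {N : Mechanism n Ω} (hN : N.IsAuction V) :
    ∑ i, ∫ z, (max (s i z) 0).toReal * N.interimAllocation μ i z ∂(μ i)
      ≤ ∑ i, ∫ z, (max (s i z) 0).toReal * interimAlloc μ (scoreAlloc s) i z ∂(μ i) := by
  have := hN.isProbabilityMeasure_seed
  have hae := Mechanism.ae_mem_valueSpace N.seed hμV
  have hb : ∀ i, ∀ᵐ p ∂(N.seed.prod (Measure.pi μ)), ‖N.alloc p.1 p.2 i‖ ≤ 1 := by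
    intro i
    filter_upwards [hae] with p hp
    rcases hN.alloc_zero_or_one p.1 p.2 hp i with h | h <;> simp [h]
  have e1 : ∀ i, ∫ z, (max (s i z) 0).toReal * N.interimAllocation μ i z ∂(μ i)
      = ∫ p : Ω × (Fin n → ℝ), (max (s i (p.2 i)) 0).toReal * N.alloc p.1 p.2 i
        ∂(N.seed.prod (Measure.pi μ)) := fun i =>
    (integral_mul_alloc (a := fun ω v => N.alloc ω v i) N.seed (hN.measurable_alloc i) (hb i) i
      (hsi i)).symm
  simp only [e1, ← integral_mul_scoreAlloc hs N.seed _ (hsi _)]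
  have i1 := fun i => integrable_mul_alloc (a := fun ω v => N.alloc ω v i) N.seed
    (hN.measurable_alloc i) (hb i) i (hsi i)
  have i2 := fun i => integrable_mul_alloc (Ω := Ω) (a := fun _ v => scoreAlloc s v i) N.seed
    ((measurable_scoreAlloc hs i).comp measurable_snd)
    (ae_of_all _ fun p => norm_scoreAlloc_le s p.2 i) i (hsi i)
  rw [← integral_finsetSum _ fun i _ => i1 i, ← integral_finsetSum _ fun i _ => i2 i]
  refine integral_mono_ae (integrable_finsetSum _ fun i _ => i1 i)
    (integrable_finsetSum _ fun i _ => i2 i) ?_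
  filter_upwards [hae] with p hp
  refine sum_mul_le_sum_scoreAlloc hst p.2 (N.alloc p.1 p.2) (fun i => ?_)
    (hN.sum_alloc_le_one p.1 p.2 hp)
  rcases hN.alloc_zero_or_one p.1 p.2 hp i with h | h <;> simp [h]

end ExpectedScore

/-! ### Revenue bounds -/

theorem coe_sum_lintegral_eq {n : ℕ} {μ : Fin n → Measure ℝ} {q : Fin n → ℝ → ℝ}
    (hq : ∀ i, Integrable (q i) (μ i)) (hq0 : ∀ i z, 0 ≤ q i z) :
    ((∑ i, ∫⁻ z, ENNReal.ofReal (q i z) ∂(μ i) : ENNReal) : EReal)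
      = ((∑ i, ∫ z, q i z ∂(μ i) : ℝ) : EReal) := by
  have h : ∀ i, ∫⁻ z, ENNReal.ofReal (q i z) ∂(μ i) = ENNReal.ofReal (∫ z, q i z ∂(μ i)) := fun i =>
    (ofReal_integral_eq_lintegral_ofReal (hq i) (ae_of_all _ (hq0 i))).symm
  have h0 : ∀ i, 0 ≤ ∫ z, q i z ∂(μ i) := fun i => integral_nonneg (hq0 i)
  simp only [h]
  rw [← ENNReal.ofReal_sum_of_nonneg fun i _ => h0 i, EReal.coe_ennreal_ofReal,
    max_eq_left (Finset.sum_nonneg fun i _ => h0 i)]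

/-- An expectation in the extended reals is at most that of an integrable upper bound. -/
theorem lintegral_sub_lintegral_le {α : Type*} [MeasurableSpace α] {P : Measure α} {g H : α → ℝ}
    (hg : AEMeasurable g P) (hH : Integrable H P) (hgH : ∀ᵐ p ∂P, g p ≤ H p) :
    ((∫⁻ p, ENNReal.ofReal (g p) ∂P : ENNReal) : EReal)
      - ((∫⁻ p, ENNReal.ofReal (-g p) ∂P : ENNReal) : EReal) ≤ ((∫ p, H p ∂P : ℝ) : EReal) := by
  have hA : ∫⁻ p, ENNReal.ofReal (g p) ∂P ≠ ⊤ := by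
    refine ne_top_of_le_ne_top hH.lintegral_lt_top.ne (lintegral_mono_ae ?_)
    filter_upwards [hgH] with p hp
    exact ENNReal.ofReal_le_ofReal hp
  -- The positive part is finite by domination, so an infinite negative part makes the difference
  -- `⊥`. Otherwise `g` is integrable.
  by_cases hB : ∫⁻ p, ENNReal.ofReal (-g p) ∂P = ⊤
  · rw [hB, EReal.coe_ennreal_top, EReal.sub_top]
    exact bot_le
  have hgi : Integrable g P := by
    refine ⟨hg.aestronglyMeasurable, ?_⟩
    rw [hasFiniteIntegral_iff_norm]
    refine lt_of_le_of_lt (lintegral_mono (g := fun p => ENNReal.ofReal (g p)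
      + ENNReal.ofReal (-g p)) fun p => ?_) ?_
    · rcases le_total 0 (g p) with h | h
      · rw [Real.norm_eq_abs, abs_of_nonneg h]; exact le_self_add
      · rw [Real.norm_eq_abs, abs_of_nonpos h]; exact le_add_self
    · rw [lintegral_add_left' hg.ennreal_ofReal]
      exact ENNReal.add_lt_top.2 ⟨hA.lt_top, Ne.lt_top hB⟩
  have h := integral_mono_ae hgi hH hgH
  rw [integral_eq_lintegral_pos_part_sub_lintegral_neg_part hgi] at h
  generalize ∫⁻ p, ENNReal.ofReal (g p) ∂P = A at *
  generalize ∫⁻ p, ENNReal.ofReal (-g p) ∂P = B at *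
  rw [← EReal.coe_le_coe_iff, EReal.coe_sub] at h
  lift A to NNReal using hA
  lift B to NNReal using hB
  exact h

namespace Mechanism

variable {n : ℕ} {Ω : Type*} [MeasurableSpace Ω] {N : Mechanism n Ω} {V : Fin n → Set ℝ}
  {μ : Fin n → Measure ℝ} [∀ i, IsProbabilityMeasure (μ i)] {C : Fin n → ℝ}

theorem IsAuction.measurable_interimAllocation (hN : N.IsAuction V) (i : Fin n) :
    Measurable (N.interimAllocation μ i) := by
  have := hN.isProbabilityMeasure_seed
  exact (measurable_resample (g := fun ω v => N.alloc ω v i)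
    (hN.measurable_alloc i) i).stronglyMeasurable.integral_prod_right'.measurable

theorem IsAuction.measurable_interimUtility (hN : N.IsAuction V) (i : Fin n) (c : ℝ) :
    Measurable fun z => N.interimUtility μ c i z z := by
  have := hN.isProbabilityMeasure_seed
  have h : Measurable fun p : ℝ × (Ω × (Fin n → ℝ)) => capUtility c
      (p.1 * N.alloc p.2.1 (Function.update p.2.2 i p.1) i
        - N.pay p.2.1 (Function.update p.2.2 i p.1) i) :=
    ((measurable_fst.mul (measurable_resample (g := fun ω v => N.alloc ω v i)
      (hN.measurable_alloc i) i)).sub (measurable_resample (g := fun ω v => N.pay ω v i)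
      (hN.measurable_pay i) i)).min measurable_const
  exact h.stronglyMeasurable.integral_prod_right'.measurable

/-- The revenue is at most the expected served value minus the agents' utilities. -/
theorem IsAuction.revenue_le (hN : N.IsAuction V) (hμV : ∀ i, μ i (V i)ᶜ = 0)
    (hC : ∀ i, 0 < C i) (hid : ∀ i, Integrable id (μ i)) :
    N.revenue μ ≤ ((∑ i, ∫ z, (z * N.interimAllocation μ i z
      - N.interimUtility μ (C i) i z z) ∂(μ i) : ℝ) : EReal) := by
  have := hN.isProbabilityMeasure_seed
  have hae := ae_mem_valueSpace N.seed hμV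
  have hb : ∀ i, ∀ᵐ p ∂(N.seed.prod (Measure.pi μ)), ‖N.alloc p.1 p.2 i‖ ≤ 1 := by
    intro i
    filter_upwards [hae] with p hp
    rcases hN.alloc_zero_or_one p.1 p.2 hp i with h | h <;> simp [h]
  have hcoord : ∀ i, Measurable fun p : Ω × (Fin n → ℝ) => p.2 i := fun i =>
    (measurable_pi_apply i).comp measurable_snd
  have i1 : ∀ i, Integrable (fun p : Ω × (Fin n → ℝ) => p.2 i * N.alloc p.1 p.2 i)
      (N.seed.prod (Measure.pi μ)) := fun i =>
    integrable_mul_alloc (a := fun ω v => N.alloc ω v i) (φ := id) N.seed (hN.measurable_alloc i)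
      (hb i) i (hid i)
  have i2 : ∀ i, Integrable (fun p : Ω × (Fin n → ℝ) =>
      capUtility (C i) (p.2 i * N.alloc p.1 p.2 i - N.pay p.1 p.2 i))
      (N.seed.prod (Measure.pi μ)) := by
    intro i
    refine Integrable.of_bound ((((hcoord i).mul (hN.measurable_alloc i)).sub
      (hN.measurable_pay i)).min measurable_const).aestronglyMeasurable (C i) ?_
    filter_upwards [hae] with p hp
    simpa using hN.abs_capUtility_le (ω := p.1) hp i (hC i) (p.2 i)
  have i3 : ∀ i, Integrable (fun p : Ω × (Fin n → ℝ) => p.2 i * N.alloc p.1 p.2 i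
      - capUtility (C i) (p.2 i * N.alloc p.1 p.2 i - N.pay p.1 p.2 i))
      (N.seed.prod (Measure.pi μ)) := fun i => (i1 i).sub (i2 i)
  have e : ∀ i, ∫ z, (z * N.interimAllocation μ i z - N.interimUtility μ (C i) i z z) ∂(μ i)
      = ∫ p : Ω × (Fin n → ℝ), (p.2 i * N.alloc p.1 p.2 i
        - capUtility (C i) (p.2 i * N.alloc p.1 p.2 i - N.pay p.1 p.2 i))
        ∂(N.seed.prod (Measure.pi μ)) := by
    intro i
    rw [integral_resample N.seed μ i (i3 i)]
    refine integral_congr_ae ?_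
    have hVi : ∀ᵐ z ∂(μ i), z ∈ V i := hμV i
    filter_upwards [hVi] with z hz
    simp only [Function.update_self]
    rw [integral_sub ((hN.integrable_alloc_update hμV hz).const_mul z)
      (hN.integrable_capUtility hμV (hC i) z hz), integral_const_mul]
    rfl
  simp only [e]
  rw [← integral_finsetSum _ fun i _ => i3 i]
  refine lintegral_sub_lintegral_le
    (Finset.measurable_sum _ fun i _ => hN.measurable_pay i).aemeasurable
    (integrable_finsetSum _ fun i _ => i3 i) (ae_of_all _ fun p => ?_)
  refine Finset.sum_le_sum fun i _ => ?_
  -- Capped utility is at most wealth, so the payment is at most the served value minus that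
  -- utility.
  have : capUtility (C i) (p.2 i * N.alloc p.1 p.2 i - N.pay p.1 p.2 i)
      ≤ p.2 i * N.alloc p.1 p.2 i - N.pay p.1 p.2 i := min_le_left _ _
  linarith

end Mechanism

theorem coe_two_mul_add_le {a b : ℝ} {M : EReal} (ha : (a : EReal) ≤ M) (hb : (b : EReal) ≤ M) :
    ((2 * a + b : ℝ) : EReal) ≤ 3 * M := by
  induction M with
  | bot => exact absurd (le_bot_iff.1 ha) (EReal.coe_ne_bot a)
  | top => rw [EReal.mul_top_of_pos (by norm_num)]; exact le_top
  | coe m =>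
    rw [EReal.coe_le_coe_iff] at ha hb
    have : (3 : EReal) * (m : EReal) = ((3 * m : ℝ) : EReal) := by norm_cast
    rw [this, EReal.coe_le_coe_iff]
    linarith

/-! ### Revenues compared with the two optimal scores -/

section Main

variable {n : ℕ} {μ : Fin n → Measure ℝ} [∀ i, IsProbabilityMeasure (μ i)] {C : Fin n → ℝ}
  {f : Fin n → ℝ → ℝ}

theorem monotone_sub_capacity (c : ℝ) : Monotone fun v : ℝ => ((v - c : ℝ) : EReal) :=
  fun a b h => EReal.coe_le_coe_iff.2 (by linarith)

/-- The expected maximal positive virtual value is a lower bound for the revenue of the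
virtual-surplus mechanism. -/
theorem virtualSurplus_le_revenue (hC : ∀ i, 0 < C i) (hμ : ∀ i, ∀ᵐ z ∂(μ i), 0 ≤ z)
    (hid : ∀ i, Integrable id (μ i)) (hf : ∀ i, IsDensity (μ i) (f i))
    (hreg : ∀ i, IsRegular (μ i) (f i)) :
    ((∑ i, ∫ z, virtualValuePos (μ i) (f i) z
        * interimAlloc μ (scoreAlloc fun i v => virtualValue (μ i) (f i) v) i z ∂(μ i) : ℝ) : EReal)
      ≤ (virtualSurplusMechanism μ f C).revenue μ := by
  set x := interimAlloc μ (scoreAlloc fun i v => virtualValue (μ i) (f i) v) with hx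
  have hxm : ∀ i, Monotone (x i) := monotone_interimAlloc_scoreAlloc μ hreg
  have hx0 : ∀ i z, 0 ≤ x i z := interimAlloc_scoreAlloc_nonneg μ
  have hx1 : ∀ i z, x i z ≤ 1 :=
    interimAlloc_scoreAlloc_le_one μ fun j => (hreg j).measurable
  have hμ0 : ∀ i, μ i (Set.Iio 0) = 0 := by
    intro i
    have h := hμ i
    rw [ae_iff] at h
    simpa [Set.Iio] using h
  have key := fun i => integral_rnPayment (hf i) (hμ0 i) (hid i) (hxm i).measurable (hx0 i) (hx1 i)
  have e : ∀ i, ∫ z, virtualValuePos (μ i) (f i) z * x i z ∂(μ i)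
      = ∫ z, rnPayment (x i) z ∂(μ i) := by
    intro i
    rw [(key i).2.2, (hf i).integral_eq (hμ0 i)]
    have hz : ∀ z, virtualValue (μ i) (f i) z ≤ 0 → x i z = 0 := fun z hz =>
      interimAlloc_scoreAlloc_eq_zero (s := fun i v => virtualValue (μ i) (f i) v) μ hz
    exact integral_congr_ae (ae_of_all _ fun v => (virtual_surplus_eq (hf i) hz v).symm)
  simp only [e]
  rw [← coe_sum_lintegral_eq (fun i => (key i).1) fun i z => rnPayment_nonneg (hxm i) z]
  exact sum_lintegral_le_revenue hreg hC hμ fun i z _ => rnPayment_le_capPayment _ _ _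

theorem sum_lintegral_valueMinusCapacity_le_revenue (hC : ∀ i, 0 < C i)
    (hμ : ∀ i, ∀ᵐ z ∂(μ i), 0 ≤ z) :
    ((∑ i, ∫⁻ z, ENNReal.ofReal (max (z - C i) 0
        * interimAlloc μ (scoreAlloc fun i v => ((v - C i : ℝ) : EReal)) i z) ∂(μ i) : ENNReal)
        : EReal)
      ≤ (valueMinusCapacityMechanism μ C).revenue μ := by
  have hs : ∀ i, Monotone fun v : ℝ => ((v - C i : ℝ) : EReal) := fun i =>
    monotone_sub_capacity (C i)
  have hxm := monotone_interimAlloc_scoreAlloc μ hs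
  refine sum_lintegral_le_revenue hs hC hμ fun i z hz => ?_
  -- Below the capacity the bound is nonnegativity of the payment; above it, the payment identity
  -- dominates `(z - C i)` times the allocation.
  rcases le_total (z - C i) 0 with h | h
  · rw [max_eq_right h, zero_mul]
    exact capPayment_nonneg (hxm i) z
  · rw [max_eq_left h]
    exact vcPayment_le_capPayment (hC i).le (interimAlloc_scoreAlloc_nonneg μ i)
      (interimAlloc_scoreAlloc_le_one μ (fun j => (hs j).measurable) i) hz

/-- The expected maximal positive value minus capacity is a lower bound for the revenue of the
value-minus-capacity mechanism. -/
theorem valueMinusCapacity_le_revenue (hC : ∀ i, 0 < C i) (hμ : ∀ i, ∀ᵐ z ∂(μ i), 0 ≤ z)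
    (hid : ∀ i, Integrable id (μ i)) :
    ((∑ i, ∫ z, max (z - C i) 0
        * interimAlloc μ (scoreAlloc fun i v => ((v - C i : ℝ) : EReal)) i z ∂(μ i) : ℝ) : EReal)
      ≤ (valueMinusCapacityMechanism μ C).revenue μ := by
  have hs : ∀ i, Monotone fun v : ℝ => ((v - C i : ℝ) : EReal) := fun i =>
    monotone_sub_capacity (C i)
  rw [← coe_sum_lintegral_eq]
  · exact sum_lintegral_valueMinusCapacity_le_revenue hC hμ
  · intro i
    refine (((hid i).sub (integrable_const (C i))).pos_part).mul_bdd (c := 1)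
      (monotone_interimAlloc_scoreAlloc μ hs i).measurable.aestronglyMeasurable
      (ae_of_all _ fun z => ?_)
    rw [Real.norm_eq_abs, abs_of_nonneg (interimAlloc_scoreAlloc_nonneg μ i z)]
    exact interimAlloc_scoreAlloc_le_one μ (fun j => (hs j).measurable) i z
  · exact fun i z => mul_nonneg (le_max_right _ _) (interimAlloc_scoreAlloc_nonneg μ i z)

/-- A finite capacity cannot absorb an infinite mean, so the expected positive part of value minus
capacity of that one agent is already infinite. The served score is at least hers in every profile.
-/
theorem revenue_valueMinusCapacity_eq_top (hC : ∀ i, 0 < C i) (hμ : ∀ i, ∀ᵐ z ∂(μ i), 0 ≤ z)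
    {i : Fin n} (hi : ¬ Integrable id (μ i)) :
    (valueMinusCapacityMechanism μ C).revenue μ = ⊤ := by
  have hs : ∀ i, Monotone fun v : ℝ => ((v - C i : ℝ) : EReal) := fun i =>
    monotone_sub_capacity (C i)
  have hsm : ∀ i, Measurable fun v : ℝ => ((v - C i : ℝ) : EReal) := fun i => (hs i).measurable
  have hψm : ∀ j, Measurable fun z : ℝ => max (z - C j) 0 := fun j =>
    (measurable_id.sub_const (C j)).max measurable_const
  have hψ0 : ∀ j (z : ℝ), 0 ≤ max (z - C j) 0 := fun _ _ => le_max_right _ _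
  have htop : ∫⁻ z, ENNReal.ofReal (max (z - C i) 0) ∂(μ i) = ⊤ := by
    by_contra hne
    refine hi ?_
    have h1 : Integrable (fun z => max (z - C i) 0) (μ i) :=
      ⟨(hψm i).aestronglyMeasurable, by
        rw [hasFiniteIntegral_iff_ofReal (ae_of_all _ (hψ0 i))]; exact Ne.lt_top hne⟩
    refine (h1.add (integrable_const (C i))).mono' measurable_id.aestronglyMeasurable ?_
    filter_upwards [hμ i] with z hz
    have := le_max_left (z - C i) 0
    simp only [id, Real.norm_eq_abs, abs_of_nonneg hz, Pi.add_apply]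
    linarith
  have hle := sum_lintegral_valueMinusCapacity_le_revenue (μ := μ) hC hμ
  rw [eq_top_iff]
  refine le_trans (le_of_eq ?_) hle
  rw [← EReal.coe_ennreal_top]
  congr 1
  symm
  rw [eq_top_iff, ← htop]
  simp only [← lintegral_mul_scoreAlloc hsm (Measure.dirac ()) _ (hψm _) (hψ0 _)]
  rw [← lintegral_finsetSum]
  swap
  · exact fun j _ => (((hψm j).comp ((measurable_pi_apply j).comp measurable_snd)).mul
      ((measurable_scoreAlloc hsm j).comp measurable_snd)).ennreal_ofReal
  have hmp : MeasurePreserving (fun p : Unit × (Fin n → ℝ) => p.2 i)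
      ((Measure.dirac ()).prod (Measure.pi μ)) (μ i) :=
    (measurePreserving_eval μ i).comp measurePreserving_snd
  rw [← hmp.lintegral_comp (hψm i).ennreal_ofReal]
  refine lintegral_mono fun p => ?_
  dsimp only
  rw [← ENNReal.ofReal_sum_of_nonneg fun j _ => mul_nonneg (hψ0 j _) (scoreAlloc_nonneg _ _ _)]
  refine ENNReal.ofReal_le_ofReal ?_
  -- The comparison allocation always serves agent `i`.
  have h := sum_mul_le_sum_scoreAlloc (s := fun i v => ((v - C i : ℝ) : EReal))
    (fun i v => EReal.coe_ne_top _) p.2 (Pi.single i 1)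
    (fun j => by by_cases hj : j = i <;> simp [hj]) (by simp)
  simp only [toReal_max_coe_zero] at h
  simpa [Pi.single_apply] using h

/-- The revenue of an incentive compatible auction is at most twice the optimal expected positive
virtual surplus plus the optimal expected surplus of value above capacity. -/
theorem revenue_le_of_integrable {Ω : Type*} [MeasurableSpace Ω] {N : Mechanism n Ω}
    {V : Fin n → Set ℝ} (hV0 : ∀ i, V i ⊆ Set.Ici 0) (hV : ∀ i, (V i).OrdConnected)
    (hμV : ∀ i, μ i (V i)ᶜ = 0) (hC : ∀ i, 0 < C i) (hid : ∀ i, Integrable id (μ i))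
    (hf : ∀ i, IsDensity (μ i) (f i)) (hreg : ∀ i, IsRegular (μ i) (f i))
    (hN : N.IsAuction V) (hB : N.IsBIC V μ C) :
    N.revenue μ ≤ ((2 * (∑ i, ∫ z, virtualValuePos (μ i) (f i) z
        * interimAlloc μ (scoreAlloc fun i v => virtualValue (μ i) (f i) v) i z ∂(μ i))
      + ∑ i, ∫ z, max (z - C i) 0
        * interimAlloc μ (scoreAlloc fun i v => ((v - C i : ℝ) : EReal)) i z ∂(μ i) : ℝ)
        : EReal) := by
  have hμ : ∀ i, ∀ᵐ z ∂(μ i), 0 ≤ z := fun i => by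
    have h : ∀ᵐ z ∂(μ i), z ∈ V i := hμV i
    filter_upwards [h] with z hz using hV0 i hz
  have hψi := fun i => integrable_virtualValuePos (hreg i) (hμ i) (hid i)
  have core := fun i => (hN.interimIC hμV hC hB i).integral_payment_le (hV0 i) (hV i)
    (hN.measurable_interimAllocation i) (hN.measurable_interimUtility i (C i)) (hC i) (hμV i)
    (hf i) (hid i) (hψi i) virtualValuePos_nonneg fun v hv => by
      rw [virtualValuePos_of_pos hv]; exact le_max_left _ _
  refine (hN.revenue_le hμV hC hid).trans ?_
  rw [EReal.coe_le_coe_iff]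
  refine (Finset.sum_le_sum fun i _ => core i).trans ?_
  rw [Finset.sum_add_distrib, ← Finset.mul_sum]
  have h1 := sum_integral_score_le (s := fun i v => virtualValue (μ i) (f i) v)
    (fun i => (hreg i).measurable) (fun i v => virtualValue_ne_top v) hψi hμV hN
  have h2 := sum_integral_score_le (s := fun i v => ((v - C i : ℝ) : EReal))
    (fun i => (monotone_sub_capacity (C i)).measurable) (fun i v => EReal.coe_ne_top _)
    (fun i => by
      simp only [toReal_max_coe_zero]
      exact ((hid i).sub (integrable_const (C i))).pos_part) hμV hN
  simp only [toReal_max_coe_zero] at h2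
  exact add_le_add (mul_le_mul_of_nonneg_left h1 zero_le_two) h2

end Main

end CapacitatedAuction

end

/-! ### The three-approximation -/

theorem theorem5p5 {n : ℕ} (C : Fin n → ℝ) (hC : ∀ i, 0 < C i)
    (V : Fin n → Set ℝ) (hV_nonneg : ∀ i, V i ⊆ Set.Ici 0) (hV_interval : ∀ i, (V i).OrdConnected)
    (μ : Fin n → MeasureTheory.Measure ℝ) [∀ i, MeasureTheory.IsProbabilityMeasure (μ i)]
    (hμV : ∀ i, μ i (V i)ᶜ = 0)
    (f : Fin n → ℝ → ℝ) (hf : ∀ i, CapacitatedAuction.IsDensity (μ i) (f i))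
    (hreg : ∀ i, CapacitatedAuction.IsRegular (μ i) (f i)) :
    (∀ M : CapacitatedAuction.Mechanism n Unit,
      (M = CapacitatedAuction.virtualSurplusMechanism μ f C ∨
        M = CapacitatedAuction.valueMinusCapacityMechanism μ C) →
      M.IsAuction V ∧ M.IsOnePriced V ∧ M.IsBIC V μ C) ∧
    ∃ M : CapacitatedAuction.Mechanism n Unit,
      (M = CapacitatedAuction.virtualSurplusMechanism μ f C ∨
        M = CapacitatedAuction.valueMinusCapacityMechanism μ C) ∧
      M.IsAuction V ∧ M.IsOnePriced V ∧ M.IsBIC V μ C ∧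
      M.revenue μ = max ((CapacitatedAuction.virtualSurplusMechanism μ f C).revenue μ)
        ((CapacitatedAuction.valueMinusCapacityMechanism μ C).revenue μ) ∧
      ∀ (Ω : Type*) [MeasurableSpace Ω] (N : CapacitatedAuction.Mechanism n Ω),
        N.IsAuction V → N.IsBIC V μ C → N.revenue μ ≤ 3 * M.revenue μ := by
  have hμ : ∀ i, ∀ᵐ z ∂(μ i), 0 ≤ z := fun i => by
    have h : ∀ᵐ z ∂(μ i), z ∈ V i := hμV i
    filter_upwards [h] with z hz using hV_nonneg i hz
  have hs2 : ∀ i, Monotone fun v : ℝ => ((v - C i : ℝ) : EReal) := fun i =>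
    CapacitatedAuction.monotone_sub_capacity (C i)
  have good : ∀ M : CapacitatedAuction.Mechanism n Unit,
      (M = CapacitatedAuction.virtualSurplusMechanism μ f C ∨
        M = CapacitatedAuction.valueMinusCapacityMechanism μ C) →
      M.IsAuction V ∧ M.IsOnePriced V ∧ M.IsBIC V μ C := by
    rintro M (rfl | rfl)
    · exact ⟨CapacitatedAuction.isAuction_paymentIdentityMechanism hreg hC hV_nonneg,
        CapacitatedAuction.isOnePriced_paymentIdentityMechanism μ C _ V,
        CapacitatedAuction.isBIC_paymentIdentityMechanism hreg hC hV_nonneg⟩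
    · exact ⟨CapacitatedAuction.isAuction_paymentIdentityMechanism hs2 hC hV_nonneg,
        CapacitatedAuction.isOnePriced_paymentIdentityMechanism μ C _ V,
        CapacitatedAuction.isBIC_paymentIdentityMechanism hs2 hC hV_nonneg⟩
  have bound : ∀ (Ω : Type _) [MeasurableSpace Ω] (N : CapacitatedAuction.Mechanism n Ω),
      N.IsAuction V → N.IsBIC V μ C → N.revenue μ
        ≤ 3 * max ((CapacitatedAuction.virtualSurplusMechanism μ f C).revenue μ)
        ((CapacitatedAuction.valueMinusCapacityMechanism μ C).revenue μ) := by
    intro Ω _ N hN hB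
    -- Finite means allow real-valued bookkeeping; an infinite mean makes the right side `⊤`.
    by_cases hid : ∀ i, MeasureTheory.Integrable id (μ i)
    · have h0 := CapacitatedAuction.revenue_le_of_integrable hV_nonneg hV_interval hμV hC hid hf
        hreg hN hB
      have h1 := (CapacitatedAuction.virtualSurplus_le_revenue hC hμ hid hf hreg).trans
        (le_max_left _ ((CapacitatedAuction.valueMinusCapacityMechanism μ C).revenue μ))
      have h2 := (CapacitatedAuction.valueMinusCapacity_le_revenue hC hμ hid).trans
        (le_max_right ((CapacitatedAuction.virtualSurplusMechanism μ f C).revenue μ) _)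
      refine h0.trans (CapacitatedAuction.coe_two_mul_add_le h1 h2)
    · push Not at hid
      obtain ⟨i, hi⟩ := hid
      rw [CapacitatedAuction.revenue_valueMinusCapacity_eq_top hC hμ hi, max_top_right,
        EReal.mul_top_of_pos (by norm_num)]
      exact le_top
  refine ⟨good, ?_⟩
  rcases max_choice ((CapacitatedAuction.virtualSurplusMechanism μ f C).revenue μ)
    ((CapacitatedAuction.valueMinusCapacityMechanism μ C).revenue μ) with h | h
  · obtain ⟨h1, h2, h3⟩ := good _ (Or.inl rfl)
    exact ⟨_, Or.inl rfl, h1, h2, h3, h.symm, fun Ω _ N hN hB => h ▸ bound Ω N hN hB⟩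
  · obtain ⟨h1, h2, h3⟩ := good _ (Or.inr rfl)
    exact ⟨_, Or.inr rfl, h1, h2, h3, h.symm, fun Ω _ N hN hB => h ▸ bound Ω N hN hB⟩
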